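/- Let $\mathcal P$ be the set of rational primes. For $\mathcal S \subseteq \mathcal P$ let $\mathbb Z[\mathcal S^{-1}]$ be the subring of $\mathbb Q$ generated by the inverses of the primes in $\mathcal S$. Fix a computable enumeration $f_0, f_1, f_2, \dots$ of all polynomials with integer coefficients in any finite number of variables, and for a commutative ring $R$ let $\operatorname{HTP}(R) \subseteq \mathbb N$ be the set of indices $n$ such that $f_n$ has a zero with all coordinates in $R$. Then there is a computably enumerable set $\mathcal S \subseteq \mathcal P$ that is infinite and co-infinite (that is, both $\mathcal S$ and $\mathcal P \setminus \mathcal S$ are infinite) such that \[ \operatorname{HTP}(\mathbb Z[\mathcal S^{-1}]) \equiv_T \operatorname{HTP}(\mathbb Q), \] where $A \equiv_T B$ means that each of the sets $A, B \subseteq \mathbb N$ is computable with an oracle for the other. -/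

import Mathlib

open MvPolynomial

/-- The integer polynomial `∑ c * X_{i₁} * ⋯ * X_{iₘ}`, the sum taken over the terms
`(c, [i₁, …, iₘ])` of the list `l`; the variables are `X₀, X₁, X₂, …`. -/
noncomputable def polyOfTerms (l : List (ℤ × List ℕ)) : MvPolynomial ℕ ℤ :=
  (l.map fun t => C t.1 * (t.2.map X).prod).sum

/-- The polynomial with index `n` in a fixed computable enumeration of `ℤ[X₀, X₁, X₂, …]`:
the index is decoded to a list of terms by Mathlib's standard numbering of `List (ℤ × List ℕ)`
(a computable bijection with `ℕ`), so the terms of the polynomial are computed from its index. -/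
noncomputable def polyOfIndex (n : ℕ) : MvPolynomial ℕ ℤ :=
  polyOfTerms (Denumerable.ofNat (List (ℤ × List ℕ)) n)

theorem polyOfTerms_surjective : Function.Surjective polyOfTerms := by
  intro f
  induction f using MvPolynomial.induction_on with
  | C a => exact ⟨[(a, [])], by simp [polyOfTerms]⟩
  | add p q hp hq =>
    obtain ⟨l, rfl⟩ := hp
    obtain ⟨m, rfl⟩ := hq
    exact ⟨l ++ m, by simp [polyOfTerms]⟩
  | mul_X p i hp =>
    obtain ⟨l, rfl⟩ := hp
    refine ⟨l.map fun t => (t.1, i :: t.2), ?_⟩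
    simp only [polyOfTerms, List.map_map, ← List.sum_map_mul_right]
    congr 1
    apply List.map_congr_left
    intro t _
    simp only [Function.comp, List.map_cons, List.prod_cons]
    ring

/-- Every integer polynomial occurs in the enumeration. -/
theorem polyOfIndex_surjective : Function.Surjective polyOfIndex := by
  intro f
  obtain ⟨l, rfl⟩ := polyOfTerms_surjective f
  exact ⟨Encodable.encode l, by simp [polyOfIndex]⟩

/-- Hilbert's Tenth Problem over `K`: the set of indices of the integer polynomials (in any number
of variables) that have a zero with coordinates in `K`. A polynomial involves only finitely many of
the variables `X₀, X₁, …`, so only finitely many values of `x` matter. -/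
def HTP (K : Type*) [CommRing K] : Set ℕ :=
  {n | ∃ x : ℕ → K, aeval x (polyOfIndex n) = 0}

/-- The subring `ℤ[S⁻¹]` of `ℚ`, generated by the inverses of the elements of `S`. -/
def invertPrimes (S : Set ℕ) : Subring ℚ :=
  Subring.closure ((fun p : ℕ => (p : ℚ)⁻¹) '' S)

open Classical in
/-- The characteristic function of a set of natural numbers (total, with values `0` and `1`). -/
noncomputable def charFun (A : Set ℕ) : ℕ →. ℕ :=
  fun n => Part.some (if n ∈ A then 1 else 0)

/-- Turing equivalence of sets of natural numbers: each characteristic function is computable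
with the other one as an oracle. -/
def SetTuringEquivalent (A B : Set ℕ) : Prop :=
  TuringEquivalent (charFun A) (charFun B)

/-! The set `S` consists of all primes except `2` and the members of a sequence of protected primes
`3 = p₀ < p₁ < …`, all congruent to `3` mod `4`. Given `p₀, …, pₑ`, ask whether the `e`-th
polynomial has a rational zero whose denominators are prime to `2, p₀, …, pₑ`. If so, the least code
of such a zero bounds its common denominator, and `pₑ₊₁` is chosen beyond that code. No later
protected prime then divides the denominator, so the zero survives in `ℤ[S⁻¹]`. Conversely, every
zero over `ℤ[S⁻¹]` has denominators of this kind. Hence the answer at step `e` decides whether `e`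
lies in `HTP(ℤ[S⁻¹])` (`mem_HTP_invertedPrimes_iff`).

The question is one about `HTP(ℚ)`, because integrality at `2` and a prime `p ≡ 3` mod `4` is
existentially definable over `ℚ` (`exists_two_add_iff_not_dvd_den`): it amounts to solving `2 + p(x²
+ z²) = u² + v²` for `x` or for `x + 1`. Necessity is a descent; sufficiency combines a
Legendre-type theorem with Dirichlet's theorem and quadratic reciprocity. So `HTP(ℚ)` computes the
protected sequence and then `HTP(ℤ[S⁻¹])`. The opposite reduction works for every subring of `ℚ`, by
clearing denominators (`exists_zero_clearDenTerms_iff`).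

`S` is computably enumerable because the sequence has computable approximations, the `s`-th using
only codes below `s`. Each of them contains every truly protected prime, and each unprotected prime
is missing from one of them (`mem_invertedPrimes_iff`). -/

/-! ### Zeros of diagonal ternary quadratic forms -/

/-- A Legendre-type theorem: a diagonal ternary form satisfying the evident congruence conditions
has a nontrivial integral zero. -/
theorem exists_diagonal_ternary_zero {a b c : ℕ} (ha : 0 < a) (hb : 0 < b) (hc : 0 < c)
    (hab : a.Coprime b) (hac : a.Coprime c) (hbc : b.Coprime c)
    (hab' : ¬ IsSquare (a * b)) (hbc' : ¬ IsSquare (b * c)) {α β γ : ℤ}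
    (hα : (a : ℤ) ∣ b * α ^ 2 - c) (hβ : (b : ℤ) ∣ a - c * β ^ 2) (hγ : (c : ℤ) ∣ a + b * γ ^ 2) :
    ∃ r s t : ℤ, a * s ^ 2 + b * t ^ 2 = c * r ^ 2 ∧ s ≠ 0 := by
  have : NeZero a := ⟨ha.ne'⟩
  have : NeZero b := ⟨hb.ne'⟩
  have : NeZero c := ⟨hc.ne'⟩
  obtain ⟨r, s, t, hne, h1, h2, h3, hr, hs, ht⟩ : ∃ r s t : ℤ, (r, s, t) ≠ (0, 0, 0) ∧
      (a : ℤ) ∣ t - α * r ∧ (b : ℤ) ∣ r - β * s ∧ (c : ℤ) ∣ t - γ * s ∧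
      r ^ 2 ≤ a * b ∧ s ^ 2 ≤ b * c ∧ t ^ 2 ≤ a * c := by
    let f : ℕ × ℕ × ℕ → ZMod a × ZMod b × ZMod c := fun p =>
      ((p.2.2 : ZMod a) - α * p.1, (p.1 : ZMod b) - β * p.2.1, (p.2.2 : ZMod c) - γ * p.2.1)
    -- Pigeonhole: the box has more than `√(ab) · √(bc) · √(ac) = abc` points, so two of them agree
    -- in all three congruences. Their difference is the required triple.
    let B : Finset (ℕ × ℕ × ℕ) := Finset.range ((a * b).sqrt + 1) ×ˢ
      Finset.range ((b * c).sqrt + 1) ×ˢ Finset.range ((a * c).sqrt + 1)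
    have hcard : (Finset.univ : Finset (ZMod a × ZMod b × ZMod c)).card < B.card := by
      simp only [B, Finset.card_univ, Fintype.card_prod, ZMod.card, Finset.card_product,
        Finset.card_range]
      have e1 := Nat.lt_succ_sqrt (a * b)
      have e2 := Nat.lt_succ_sqrt (b * c)
      have e3 := Nat.lt_succ_sqrt (a * c)
      simp only [Nat.succ_eq_add_one] at e1 e2 e3
      refine lt_of_pow_lt_pow_left₀ 2 (Nat.zero_le _) ?_
      calc (a * (b * c)) ^ 2 = (a * b) * ((b * c) * (a * c)) := by ring
        _ < (((a * b).sqrt + 1) * ((a * b).sqrt + 1)) * ((((b * c).sqrt + 1) * ((b * c).sqrt + 1)) *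
            (((a * c).sqrt + 1) * ((a * c).sqrt + 1))) := by gcongr
        _ = _ := by ring
    obtain ⟨x, hx, y, hy, hxy, hf⟩ := Finset.exists_ne_map_eq_of_card_lt_of_maps_to hcard
      (f := f) (fun _ _ => Finset.mem_coe.2 (Finset.mem_univ _))
    obtain ⟨x1, x2, x3⟩ := x
    obtain ⟨y1, y2, y3⟩ := y
    simp only [B, Finset.mem_product, Finset.mem_range, Nat.lt_succ_iff] at hx hy
    simp only [f, Prod.mk.injEq] at hf
    have key : ∀ {m n k : ℕ}, m ≤ k.sqrt → n ≤ k.sqrt → ((m : ℤ) - n) ^ 2 ≤ k := by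
      intro m n k hm hn
      have h0 : (k.sqrt : ℤ) * k.sqrt ≤ k := by exact_mod_cast Nat.sqrt_le k
      have hm' : (m : ℤ) ≤ k.sqrt := by exact_mod_cast hm
      have hn' : (n : ℤ) ≤ k.sqrt := by exact_mod_cast hn
      have : ((m : ℤ) - n) ^ 2 ≤ (k.sqrt : ℤ) ^ 2 := by
        apply sq_le_sq'  <;> omega
      nlinarith
    refine ⟨x1 - y1, x2 - y2, x3 - y3, ?_, ?_, ?_, ?_, ?_, ?_, ?_⟩
    · intro h
      simp only [Prod.mk.injEq, sub_eq_zero, Nat.cast_inj] at h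
      exact hxy (by simp [h])
    · rw [← ZMod.intCast_zmod_eq_zero_iff_dvd]
      push_cast
      linear_combination hf.1
    · rw [← ZMod.intCast_zmod_eq_zero_iff_dvd]
      push_cast
      linear_combination hf.2.1
    · rw [← ZMod.intCast_zmod_eq_zero_iff_dvd]
      push_cast
      linear_combination hf.2.2
    · exact_mod_cast key hx.1 hy.1
    · exact_mod_cast key hx.2.1 hy.2.1
    · exact_mod_cast key hx.2.2 hy.2.2
  have da : (a : ℤ) ∣ a * s ^ 2 + b * t ^ 2 - c * r ^ 2 := by
    have : (a * s ^ 2 + b * t ^ 2 - c * r ^ 2 : ℤ) =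
      a * s ^ 2 + (t - α * r) * (b * (t + α * r)) + (b * α ^ 2 - c) * r ^ 2 := by ring
    rw [this]
    exact dvd_add (dvd_add (Dvd.intro _ rfl) (h1.mul_right _)) (hα.mul_right _)
  have db : (b : ℤ) ∣ a * s ^ 2 + b * t ^ 2 - c * r ^ 2 := by
    have : (a * s ^ 2 + b * t ^ 2 - c * r ^ 2 : ℤ) =
      b * t ^ 2 + (r - β * s) * (-c * (r + β * s)) + (a - c * β ^ 2) * s ^ 2 := by ring
    rw [this]
    exact dvd_add (dvd_add (Dvd.intro _ rfl) (h2.mul_right _)) (hβ.mul_right _)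
  have dc : (c : ℤ) ∣ a * s ^ 2 + b * t ^ 2 - c * r ^ 2 := by
    have : (a * s ^ 2 + b * t ^ 2 - c * r ^ 2 : ℤ) =
      c * (-r ^ 2) + (t - γ * s) * (b * (t + γ * s)) + (a + b * γ ^ 2) * s ^ 2 := by ring
    rw [this]
    exact dvd_add (dvd_add (Dvd.intro _ rfl) (h3.mul_right _)) (hγ.mul_right _)
  have dabc : (a * b * c : ℤ) ∣ a * s ^ 2 + b * t ^ 2 - c * r ^ 2 := by
    refine IsCoprime.mul_dvd ?_ (IsCoprime.mul_dvd ?_ da db) dc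
    · exact IsCoprime.mul_left (Nat.isCoprime_iff_coprime.2 hac) (Nat.isCoprime_iff_coprime.2 hbc)
    · exact Nat.isCoprime_iff_coprime.2 hab
  obtain ⟨k, hk⟩ := dabc
  have ha' : (0 : ℤ) < a := by exact_mod_cast ha
  have hb' : (0 : ℤ) < b := by exact_mod_cast hb
  have hc' : (0 : ℤ) < c := by exact_mod_cast hc
  have hpos : (0 : ℤ) < a * b * c := by positivity
  -- Strictness in these two bounds puts `as² + bt² - cr² = abc·k` strictly between `-abc` and
  -- `2abc`, leaving `k = 0` or `k = 1`.
  have hr' : r ^ 2 < a * b := by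
    refine lt_of_le_of_ne hr fun h => hab' ⟨r.natAbs, ?_⟩
    zify
    rw [← h, ← sq, sq_abs]
  have hs' : s ^ 2 < b * c := by
    refine lt_of_le_of_ne hs fun h => hbc' ⟨s.natAbs, ?_⟩
    zify
    rw [← h, ← sq, sq_abs]
  have hk1 : -1 < k := by
    by_contra hcon
    have : a * b * c * k ≤ a * b * c * (-1) := by gcongr; omega
    nlinarith [mul_lt_mul_of_pos_left hr' hc', sq_nonneg s, sq_nonneg t,
      mul_nonneg ha'.le (sq_nonneg s), mul_nonneg hb'.le (sq_nonneg t)]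
  have hk2 : k < 2 := by
    by_contra hcon
    have : (a * b * c * 2 : ℤ) ≤ a * b * c * k := by gcongr; omega
    nlinarith [mul_lt_mul_of_pos_left hs' ha', mul_le_mul_of_nonneg_left ht hb'.le,
      mul_nonneg hc'.le (sq_nonneg r)]
  have final : ∀ r s t : ℤ, (r, s, t) ≠ (0, 0, 0) → a * s ^ 2 + b * t ^ 2 = c * r ^ 2 →
      s ≠ 0 := by
    rintro r s t hne h rfl
    have h' : (b * t ^ 2 : ℤ) = c * r ^ 2 := by linear_combination h
    have hr0 : r ≠ 0 := by
      rintro rfl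
      have : t = 0 := by
        have : (b * t ^ 2 : ℤ) = 0 := by linear_combination h'
        simpa [hb.ne'] using this
      exact hne (by simp [this])
    apply hbc'
    have h2 : (b * c : ℚ) = ((b * t / r : ℚ)) ^ 2 := by
      have h'' : (b * t ^ 2 : ℚ) = c * r ^ 2 := by exact_mod_cast h'
      have : (r : ℚ) ≠ 0 := by exact_mod_cast hr0
      field_simp
      linear_combination -h''
    have h3 : IsSquare ((b * c : ℕ) : ℚ) := ⟨b * t / r, by push_cast; rw [h2]; ring⟩
    exact Rat.isSquare_natCast_iff.1 h3
  obtain rfl | rfl : k = 0 ∨ k = 1 := by omega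
  · exact ⟨r, s, t, by linear_combination hk, final r s t hne (by linear_combination hk)⟩
  · have hz : (0 : ℤ) < r ^ 2 + a * b := by positivity
    -- For `k = 1`, `as² + bt² = c(r² + ab)`; multiplying by the norm `r² + ab` and composing the
    -- forms gives a genuine zero.
    have e : (a * (s * r + b * t) ^ 2 + b * (t * r - a * s) ^ 2 : ℤ) = c * (r ^ 2 + a * b) ^ 2 := by
      linear_combination (r ^ 2 + a * b) * hk
    refine ⟨r ^ 2 + a * b, s * r + b * t, t * r - a * s, e, final _ _ _ ?_ e⟩
    intro h
    simp only [Prod.mk.injEq] at h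
    exact hz.ne' h.1

/-! ### Existential definability of integrality at 2 and p -/

-- With `M = 2n² + pm²`, it suffices to solve `Ms² + pt² = lr²` for some prime `l ≡ 1` mod `4`,
-- since such an `l` is a sum of two squares. Dirichlet's theorem provides an `l` that meets the
-- congruence conditions of `exists_diagonal_ternary_zero`.
open NumberTheorySymbols in
theorem exists_sq_add_sq_of_odd {p : ℕ} (hp : p.Prime) (hp4 : p % 4 = 3) {n m : ℕ} (hn : Odd n)
    (hm : Odd m) (hpn : ¬ p ∣ n) :
    ∃ s t u v : ℤ, s ≠ 0 ∧ (2 * n ^ 2 + p * m ^ 2) * s ^ 2 + p * t ^ 2 = u ^ 2 + v ^ 2 := by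
  have := Fact.mk hp
  set M := 2 * n ^ 2 + p * m ^ 2 with hM
  have hpodd : Odd p := Nat.odd_iff.2 (by omega)
  have hp2 : p ≠ 2 := by omega
  have hM4 : M % 4 = 1 := by
    obtain ⟨i, rfl⟩ := hn
    obtain ⟨j, rfl⟩ := hm
    obtain ⟨k, hk⟩ : ∃ k, p = 4 * k + 3 := ⟨p / 4, by omega⟩
    have : M = 4 * (2 * i ^ 2 + 2 * i + (4 * k + 3) * (j ^ 2 + j) + k + 1) + 1 := by
      rw [hM, hk]; ring
    omega
  have hModd : Odd M := Nat.odd_iff.2 (by omega)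
  have hMpos : 0 < M := by omega
  have hpM : ¬ p ∣ M := by
    intro h
    have : p ∣ 2 * n ^ 2 := (Nat.dvd_add_left (Dvd.intro _ rfl)).1 h
    rcases hp.dvd_mul.1 this with h | h
    · exact hp2 ((Nat.prime_dvd_prime_iff_eq hp Nat.prime_two).1 h)
    · exact hpn (hp.dvd_of_dvd_pow h)
  have cpM : p.Coprime M := hp.coprime_iff_not_dvd.2 hpM
  have c4p : Nat.Coprime 4 p := by
    have : Nat.Coprime (2 ^ 2) p := Nat.Coprime.pow_left _ (Nat.coprime_two_left.2 hpodd)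
    exact this
  have c4M : Nat.Coprime 4 M := by
    have : Nat.Coprime (2 ^ 2) M := Nat.Coprime.pow_left _ (Nat.coprime_two_left.2 hModd)
    exact this
  have c2p : Nat.Coprime 2 p := Nat.coprime_two_left.2 hpodd
  -- The residues for `l`: `1` mod `4`; `2` mod `p`, so that `M ≡ 2n² ≡ ln²`; and `p` mod `M`, so
  -- that `p·1² ≡ l`.
  obtain ⟨x, hx4, hxp⟩ := Nat.chineseRemainder c4p 1 2
  obtain ⟨y, hyx, hyM⟩ := Nat.chineseRemainder (Nat.Coprime.mul_left c4M cpM) x p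
  have hy4 : y ≡ 1 [MOD 4] := (hyx.of_mul_right p).trans hx4
  have hyp : y ≡ 2 [MOD p] := (hyx.of_mul_left 4).trans hxp
  have hcop : y.Coprime (4 * p * M) := by
    refine Nat.Coprime.mul_right (Nat.Coprime.mul_right ?_ ?_) ?_
    · rw [Nat.Coprime, hy4.gcd_eq]; simp
    · rw [Nat.Coprime, hyp.gcd_eq]; exact c2p
    · rw [Nat.Coprime, hyM.gcd_eq]; exact cpM
  obtain ⟨l, hlgt, hl, hly⟩ := Nat.forall_exists_prime_gt_and_modEq (p + M)
    (q := 4 * p * M) (by have := hp.pos; positivity) hcop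
  have := Fact.mk hl
  have hl4 : l ≡ 1 [MOD 4] := ((hly.of_mul_right M).of_mul_right p).trans hy4
  have hlp : l ≡ 2 [MOD p] := ((hly.of_mul_right M).of_mul_left 4).trans hyp
  have hlM : l ≡ p [MOD M] := (hly.of_mul_left _).trans hyM
  have hl41 : l % 4 = 1 := hl4
  have hlodd : Odd l := Nat.odd_iff.2 (by omega)
  have hMl : M.Coprime l := ((hl.coprime_iff_not_dvd).2
    fun h => absurd (Nat.le_of_dvd hMpos h) (by omega)).symm
  have hpl : p.Coprime l := (Nat.coprime_primes hp hl).2 (by omega)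
  have J2 : J(2 | p) * J(2 | p) = 1 := by
    have := jacobiSym.sq_one (a := 2) (b := p) (by exact_mod_cast c2p)
    rwa [sq] at this
  -- Reciprocity without signs, as `l` and `M` are both `1` mod `4`: `(M|l) = (l|M) = (p|M) = (M|p)
  -- = (2n²|p) = (2|p)`.
  have J1 : J((M : ℤ) | l) = J(2 | p) := by
    rw [jacobiSym.quadratic_reciprocity_one_mod_four' hModd hl41,
      jacobiSym.mod_left' (a₂ := (p : ℤ)) (by exact_mod_cast hlM),
      ← jacobiSym.quadratic_reciprocity_one_mod_four hM4 hpodd,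
      jacobiSym.mod_left' (a₂ := 2 * (n : ℤ) ^ 2) (by rw [hM]; push_cast; simp),
      jacobiSym.mul_left, jacobiSym.sq_one', mul_one]
    exact_mod_cast (hp.coprime_iff_not_dvd.2 hpn).symm
  have J3 : J((p : ℤ) | l) = J(2 | p) := by
    rw [jacobiSym.quadratic_reciprocity_one_mod_four' hpodd hl41,
      jacobiSym.mod_left' (a₂ := (2 : ℤ)) (by exact_mod_cast hlp)]
  have Jneg : J(-((M : ℤ) * p) | l) = 1 := by
    rw [jacobiSym.neg _ hlodd, ZMod.χ₄_nat_one_mod_four hl41, jacobiSym.mul_left, J1, J3, J2, one_mul]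
  obtain ⟨κ, hκ⟩ := ZMod.isSquare_of_jacobiSym_eq_one Jneg
  have hp0 : (p : ZMod l) ≠ 0 := by
    rw [Ne, ZMod.natCast_eq_zero_iff]
    exact fun h => hl.one_lt.ne' ((Nat.Coprime.eq_one_of_dvd hpl.symm h))
  -- From `κ² = -Mp` mod `l`, the quotient `γ = κ/p` satisfies `M + pγ² = 0` mod `l`.
  obtain ⟨γ, hγ⟩ : ∃ γ : ℤ, (γ : ZMod l) = κ / p := ZMod.intCast_surjective _
  obtain ⟨r, s, t, h, hs⟩ := exists_diagonal_ternary_zero (a := M) (b := p) (c := l) hMpos hp.pos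
    hl.pos cpM.symm hMl hpl
    (by
      rintro ⟨k, hk⟩
      have hpk : p ∣ k := by
        have : p ∣ k * k := ⟨M, by rw [← hk]; ring⟩
        simpa using hp.dvd_mul.1 this
      obtain ⟨j, rfl⟩ := hpk
      exact hpM ⟨j * j, Nat.eq_of_mul_eq_mul_right hp.pos (by linarith)⟩)
    (by
      rintro ⟨k, hk⟩
      have hpk : p ∣ k := by
        have : p ∣ k * k := ⟨l, by rw [← hk]⟩
        simpa using hp.dvd_mul.1 this
      obtain ⟨j, rfl⟩ := hpk
      have : p ∣ l := ⟨j * j, Nat.eq_of_mul_eq_mul_left hp.pos (by linarith)⟩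
      exact (hp.coprime_iff_not_dvd.1 hpl) this)
    (α := 1) (β := n) (γ := γ)
    (by
      have := (Nat.modEq_iff_dvd.1 hlM)
      simpa using this)
    (by
      rw [← ZMod.intCast_zmod_eq_zero_iff_dvd]
      have : (l : ZMod p) = (2 : ℕ) := (ZMod.natCast_eq_natCast_iff _ _ _).2 hlp
      rw [hM]
      push_cast
      rw [this]
      simp)
    (by
      rw [← ZMod.intCast_zmod_eq_zero_iff_dvd]
      push_cast
      rw [hγ]
      push_cast at hκ
      field_simp
      linear_combination -hκ)
  obtain ⟨u, v, huv⟩ := Nat.Prime.sq_add_sq (p := l) (by omega)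
  refine ⟨s, t, u * r, v * r, hs, ?_⟩
  have huv' : (u ^ 2 + v ^ 2 : ℤ) = l := by exact_mod_cast huv
  have hM' : (M : ℤ) = 2 * n ^ 2 + p * m ^ 2 := by rw [hM]; push_cast; ring
  rw [← hM']
  linear_combination h - r ^ 2 * huv'

theorem exists_rat_sq_add_sq_of_odd {p : ℕ} (hp : p.Prime) (hp4 : p % 4 = 3) {n : ℕ} {m : ℤ}
    (hn : Odd n) (hm : Odd m) (hpn : ¬ p ∣ n) :
    ∃ z u v : ℚ, 2 + p * ((m / n : ℚ) ^ 2 + z ^ 2) = u ^ 2 + v ^ 2 := by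
  obtain ⟨s, t, u, v, hs, h⟩ := exists_sq_add_sq_of_odd hp hp4 hn (Int.natAbs_odd.2 hm) hpn
  have hn0 : (n : ℚ) ≠ 0 := by
    rintro h0
    rw [Nat.cast_eq_zero.1 h0] at hpn
    simp at hpn
  have hs0 : (s : ℚ) ≠ 0 := by exact_mod_cast hs
  refine ⟨t / (s * n), u / (s * n), v / (s * n), ?_⟩
  have hm2 : ((m.natAbs : ℤ)) ^ 2 = m ^ 2 := by simp
  rw [hm2] at h
  have h' : ((2 * n ^ 2 + p * m ^ 2) * s ^ 2 + p * t ^ 2 : ℚ) = u ^ 2 + v ^ 2 := by exact_mod_cast h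
  field_simp
  linear_combination h'

theorem dvd_and_dvd_of_dvd_sq_add_sq {p : ℕ} (hp : p.Prime) (hp4 : p % 4 = 3) {c e : ℤ}
    (h : (p : ℤ) ∣ c ^ 2 + e ^ 2) : (p : ℤ) ∣ c ∧ (p : ℤ) ∣ e := by
  have := Fact.mk hp
  have h0 : (c : ZMod p) ^ 2 + (e : ZMod p) ^ 2 = 0 := by
    exact_mod_cast (ZMod.intCast_zmod_eq_zero_iff_dvd _ p).2 h
  simp only [← ZMod.intCast_zmod_eq_zero_iff_dvd]
  by_cases he : (e : ZMod p) = 0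
  · rw [he] at h0
    exact ⟨by simpa using h0, he⟩
  · exact absurd hp4 (ZMod.mod_four_ne_three_of_sq_eq_neg_sq' he (eq_neg_of_add_eq_zero_left h0))

/-- Work mod `8`, where `2d²` vanishes. If `a` and `b` are both odd, the left side is `6`, not a sum
of two squares mod `8`; if just one is odd, it is `3` mod `4`. With both even it is `0` mod `4`,
which forces `c` and `e` to be even. -/
theorem even_of_two_mul_sq_add {p : ℕ} (hp4 : p % 4 = 3) {d a b c e : ℤ} (hd : 2 ∣ d)
    (h : 2 * d ^ 2 + p * (a ^ 2 + b ^ 2) = c ^ 2 + e ^ 2) : 2 ∣ a ∧ 2 ∣ b ∧ 2 ∣ c ∧ 2 ∣ e := by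
  obtain ⟨k, hk⟩ : ∃ k : ℕ, p = 4 * k + 3 := ⟨p / 4, by omega⟩
  obtain ⟨d, rfl⟩ := hd
  have hk' : (p : ℤ) = 4 * k + 3 := by exact_mod_cast hk
  rw [hk'] at h
  have par : ∀ x : ℤ, (2 ∣ x ∧ ∃ y, x ^ 2 = 4 * y) ∨ ∃ y, x ^ 2 = 8 * y + 1 := by
    intro x
    rcases Int.even_or_odd x with ⟨y, rfl⟩ | hx
    · exact Or.inl ⟨⟨y, by ring⟩, y ^ 2, by ring⟩
    · right
      obtain ⟨y, hy⟩ := Int.eight_dvd_sq_sub_one_of_odd hx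
      exact ⟨y, by linarith⟩
  have e1 : (2 * (2 * d) ^ 2 : ℤ) = 8 * d ^ 2 := by ring
  rw [e1] at h
  generalize d ^ 2 = D at h
  rcases par a with ⟨ha, a', ha'⟩ | ⟨a', ha'⟩ <;> rcases par b with ⟨hb, b', hb'⟩ | ⟨b', hb'⟩ <;>
  rcases par c with ⟨hc, c', hc'⟩ | ⟨c', hc'⟩ <;> rcases par e with ⟨he, e', he'⟩ | ⟨e', he'⟩ <;>
  first
  | exact ⟨ha, hb, hc, he⟩
  | (exfalso
     rw [ha', hb', hc', he'] at h
     ring_nf at h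
     generalize (k : ℤ) * a' = u at h
     generalize (k : ℤ) * b' = v at h
     omega)

/-- Infinite descent on `d`: if `q` divides the denominator of `x = a/d`, it divides `d` and then
all the other variables, so the equation can be divided by `q²` without changing `x`. For `q = p`
this uses that `-1` is not a square mod `p`, applied first to `c² + e²` and then to `a² + b²`. -/
theorem not_dvd_den_of_two_mul_sq_add {p q : ℕ} (hp : p.Prime) (hp4 : p % 4 = 3)
    (hq : q = 2 ∨ q = p) {d : ℕ} (hd : 0 < d) {a b c e : ℤ}
    (h : 2 * (d : ℤ) ^ 2 + p * (a ^ 2 + b ^ 2) = c ^ 2 + e ^ 2) {x : ℚ} (hx : x = a / d) :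
    ¬ q ∣ x.den := by
  induction d using Nat.strong_induction_on generalizing a b c e with
  | _ d ih =>
    intro hqx
    have hqprime : q.Prime := by rcases hq with rfl | rfl; exacts [Nat.prime_two, hp]
    have hxd : x.den ∣ d := by
      rw [hx]
      have := Rat.den_dvd a d
      rw [Rat.divInt_eq_div] at this
      exact_mod_cast this
    obtain ⟨d', rfl⟩ := hqx.trans hxd
    have hd' : 0 < d' := Nat.pos_of_mul_pos_left hd
    have hq0 : (q : ℤ) ≠ 0 := by exact_mod_cast hqprime.ne_zero
    have hq0' : (q : ℚ) ≠ 0 := by exact_mod_cast hqprime.ne_zero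
    obtain ⟨ha, hb, hc, he⟩ : (q : ℤ) ∣ a ∧ (q : ℤ) ∣ b ∧ (q : ℤ) ∣ c ∧ (q : ℤ) ∣ e := by
      rcases hq with rfl | rfl
      · exact even_of_two_mul_sq_add hp4 ⟨d', by push_cast; ring⟩ h
      · have hce : (q : ℤ) ∣ c ^ 2 + e ^ 2 :=
          ⟨2 * q * d' ^ 2 + (a ^ 2 + b ^ 2), by rw [← h]; push_cast; ring⟩
        obtain ⟨⟨c', rfl⟩, ⟨e', rfl⟩⟩ := dvd_and_dvd_of_dvd_sq_add_sq hp hp4 hce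
        have hab : (q : ℤ) ∣ a ^ 2 + b ^ 2 := by
          refine ⟨c' ^ 2 + e' ^ 2 - 2 * d' ^ 2, ?_⟩
          apply mul_left_cancel₀ hq0
          push_cast at h
          linear_combination h
        obtain ⟨ha, hb⟩ := dvd_and_dvd_of_dvd_sq_add_sq hp hp4 hab
        exact ⟨ha, hb, Dvd.intro _ rfl, Dvd.intro _ rfl⟩
    obtain ⟨a, rfl⟩ := ha
    obtain ⟨b, rfl⟩ := hb
    obtain ⟨c, rfl⟩ := hc
    obtain ⟨e, rfl⟩ := he
    refine ih d' ?_ hd' (a := a) (b := b) (c := c) (e := e) ?_ ?_ hqx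
    · have := hqprime.two_le
      nlinarith
    · apply mul_left_cancel₀ (pow_ne_zero 2 hq0)
      push_cast at h
      linear_combination h
    · rw [hx]
      push_cast
      rw [mul_div_mul_left _ _ hq0']

theorem not_dvd_den_of_two_add {p q : ℕ} (hp : p.Prime) (hp4 : p % 4 = 3) (hq : q = 2 ∨ q = p)
    {x z u v : ℚ} (h : 2 + p * (x ^ 2 + z ^ 2) = u ^ 2 + v ^ 2) : ¬ q ∣ x.den := by
  have hx := Rat.num_div_den x
  have hz := Rat.num_div_den z
  have hu := Rat.num_div_den u
  have hv := Rat.num_div_den v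
  have hx0 : (x.den : ℚ) ≠ 0 := by exact_mod_cast x.den_ne_zero
  have hz0 : (z.den : ℚ) ≠ 0 := by exact_mod_cast z.den_ne_zero
  have hu0 : (u.den : ℚ) ≠ 0 := by exact_mod_cast u.den_ne_zero
  have hv0 : (v.den : ℚ) ≠ 0 := by exact_mod_cast v.den_ne_zero
  refine not_dvd_den_of_two_mul_sq_add hp hp4 hq (d := x.den * z.den * u.den * v.den)
    (a := x.num * (z.den * u.den * v.den)) (b := z.num * (x.den * u.den * v.den))
    (c := u.num * (x.den * z.den * v.den)) (e := v.num * (x.den * z.den * u.den)) ?_ ?_ ?_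
  · have := x.den_pos; have := z.den_pos; have := u.den_pos; have := v.den_pos
    positivity
  · rw [← hx, ← hz, ← hu, ← hv] at h
    field_simp at h
    have h' : (((2 * ((x.den * z.den * u.den * v.den : ℕ) : ℤ) ^ 2 + p * ((x.num * (z.den * u.den *
      v.den)) ^ 2 + (z.num * (x.den * u.den * v.den)) ^ 2) : ℤ)) : ℚ) =
      (((u.num * (x.den * z.den * v.den)) ^ 2 + (v.num * (x.den * z.den * u.den)) ^ 2 : ℤ) : ℚ) := by
      push_cast
      linear_combination h
    exact_mod_cast h'
  · push_cast
    nth_rewrite 1 [← hx]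
    field_simp

/-- For a prime `p ≡ 3 mod 4`, integrality at both `2` and `p` is existentially definable
over `ℚ`. -/
theorem exists_two_add_iff_not_dvd_den {p : ℕ} (hp : p.Prime) (hp4 : p % 4 = 3) (x : ℚ) :
    (∃ z u v : ℚ, (2 + p * (x ^ 2 + z ^ 2) - (u ^ 2 + v ^ 2)) *
      (2 + p * ((x + 1) ^ 2 + z ^ 2) - (u ^ 2 + v ^ 2)) = 0) ↔ ¬ 2 ∣ x.den ∧ ¬ p ∣ x.den := by
  constructor
  · rintro ⟨z, u, v, h⟩
    suffices H : ∀ q : ℕ, q = 2 ∨ q = p → ¬ q ∣ x.den from ⟨H 2 (Or.inl rfl), H p (Or.inr rfl)⟩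
    intro q hq
    rcases mul_eq_zero.1 h with h | h
    · exact not_dvd_den_of_two_add hp hp4 hq (sub_eq_zero.1 h)
    · have h1 := not_dvd_den_of_two_add hp hp4 hq (sub_eq_zero.1 h)
      have h2 : x.den ∣ (x + 1).den := by simp
      exact fun h3 => h1 (h3.trans h2)
  · rintro ⟨h2, hpx⟩
    have hodd : Odd x.den := by rwa [← Nat.not_even_iff_odd, even_iff_two_dvd]
    -- Solvability is known only for odd numerators; when the numerator of `x` is even, that of `x +
    -- 1` over the same odd denominator is odd.
    rcases Int.even_or_odd x.num with hnum | hnum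
    · have h1 : Odd (x.num + x.den) := hnum.add_odd (by exact_mod_cast hodd)
      obtain ⟨z, u, v, h⟩ := exists_rat_sq_add_sq_of_odd hp hp4 hodd h1 hpx
      refine ⟨z, u, v, ?_⟩
      have hx0 : (x.den : ℚ) ≠ 0 := by exact_mod_cast x.den_ne_zero
      have : ((x.num + x.den : ℤ) / x.den : ℚ) = x + 1 := by
        push_cast
        rw [add_div, div_self hx0, Rat.num_div_den]
      rw [this] at h
      rw [h]
      ring
    · obtain ⟨z, u, v, h⟩ := exists_rat_sq_add_sq_of_odd hp hp4 hodd hnum hpx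
      refine ⟨z, u, v, ?_⟩
      rw [Rat.num_div_den] at h
      rw [h]
      ring

/-! ### Denominators in localizations of ℤ -/

theorem mem_invertPrimes_iff {S : Set ℕ} (hS : ∀ p ∈ S, Nat.Prime p) {x : ℚ} :
    x ∈ invertPrimes S ↔ ∀ q : ℕ, q.Prime → q ∣ x.den → q ∈ S := by
  constructor
  · intro hx
    induction hx using Subring.closure_induction with
    | mem x hx =>
      obtain ⟨p, hp, rfl⟩ := hx
      intro q hq hqd
      rw [Rat.inv_natCast_den_of_pos (hS p hp).pos] at hqd
      rwa [(Nat.prime_dvd_prime_iff_eq hq (hS p hp)).1 hqd]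
    | zero => intro q hq hqd; exact absurd (Nat.dvd_one.1 hqd) hq.one_lt.ne'
    | one => intro q hq hqd; exact absurd (Nat.dvd_one.1 hqd) hq.one_lt.ne'
    | add x y _ _ hx hy =>
      intro q hq hqd
      exact (hq.dvd_mul.1 (hqd.trans (Rat.add_den_dvd x y))).elim (hx q hq) (hy q hq)
    | neg x _ hx => simpa using hx
    | mul x y _ _ hx hy =>
      intro q hq hqd
      exact (hq.dvd_mul.1 (hqd.trans (Rat.mul_den_dvd x y))).elim (hx q hq) (hy q hq)
  · intro h
    have key : ∀ n : ℕ, n ≠ 0 → (∀ q : ℕ, q.Prime → q ∣ n → q ∈ S) →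
        (n : ℚ)⁻¹ ∈ invertPrimes S := by
      intro n
      induction n using induction_on_primes with
      | zero => simp
      | one => simp
      | prime_mul p a hp ih =>
        intro h0 hq
        push_cast
        rw [mul_inv]
        exact mul_mem (Subring.subset_closure ⟨p, hq p hp (Dvd.intro _ rfl), rfl⟩)
          (ih (right_ne_zero_of_mul h0) fun q hq' hqa => hq q hq' (hqa.mul_left p))
    rw [← Rat.num_div_den x, div_eq_mul_inv]
    exact mul_mem (intCast_mem _ _) (key _ x.den_ne_zero h)

theorem exists_common_den (L : List ℕ) (x : ℕ → ℚ) :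
    ∃ (d : ℕ) (a : ℕ → ℤ), d ≠ 0 ∧ (∀ i ∈ L, (a i : ℚ) = d * x i) ∧ (∀ i, i ∉ L → a i = 0) ∧
      ∀ q : ℕ, q.Prime → q ∣ d → ∃ i ∈ L, q ∣ (x i).den := by
  refine ⟨(L.map fun i => (x i).den).prod, fun i => if i ∈ L then
    (((L.map fun i => (x i).den).prod : ℕ) * x i).num else 0, ?_, ?_, ?_, ?_⟩
  · simp [List.prod_eq_zero_iff]
  · intro i hi
    simp only [hi, if_true]
    rw [← Rat.den_eq_one_iff]
    obtain ⟨k, hk⟩ : (x i).den ∣ (L.map fun i => (x i).den).prod :=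
      List.dvd_prod (List.mem_map_of_mem hi)
    rw [hk]
    have : (((x i).den * k : ℕ) : ℚ) * x i = ((k * (x i).num : ℤ) : ℚ) := by
      push_cast
      rw [← Rat.den_mul_eq_num]
      ring
    rw [this]
    exact Rat.den_intCast _
  · intro i hi
    simp [hi]
  · intro q hq hqd
    obtain ⟨a, ha, hqa⟩ := (hq.prime.dvd_prod_iff).1 hqd
    obtain ⟨i, hi, rfl⟩ := List.mem_map.1 ha
    exact ⟨i, hi, hqa⟩

/-! ### Arithmetic of polynomials given by lists of terms -/

/-- The value at `x` of the polynomial with the given list of terms. -/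
def evalTerms {R : Type*} [CommRing R] (x : ℕ → R) (l : List (ℤ × List ℕ)) : R :=
  (l.map fun t => (t.1 : R) * (t.2.map x).prod).sum

section evalTerms

variable {R R' : Type*} [CommRing R] [CommRing R']

theorem aeval_polyOfTerms (x : ℕ → R) (l : List (ℤ × List ℕ)) :
    aeval x (polyOfTerms l) = evalTerms x l := by
  simp only [polyOfTerms, evalTerms, map_list_sum, List.map_map]
  congr 1
  apply List.map_congr_left
  intro t _
  simp [map_list_prod, Function.comp_def]

theorem mem_HTP_iff {n : ℕ} : n ∈ HTP R ↔
    ∃ x : ℕ → R, evalTerms x (Denumerable.ofNat (List (ℤ × List ℕ)) n) = 0 := by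
  simp [HTP, polyOfIndex, aeval_polyOfTerms]

theorem encode_mem_HTP_iff {l : List (ℤ × List ℕ)} : Encodable.encode l ∈ HTP R ↔
    ∃ x : ℕ → R, evalTerms x l = 0 := by
  rw [mem_HTP_iff, Denumerable.ofNat_encode]

theorem map_evalTerms (φ : R →+* R') (x : ℕ → R) (l : List (ℤ × List ℕ)) :
    φ (evalTerms x l) = evalTerms (fun i => φ (x i)) l := by
  simp only [evalTerms, map_list_sum, List.map_map]
  congr 1
  apply List.map_congr_left
  intro t _
  simp [map_list_prod, Function.comp_def]

@[simp] theorem evalTerms_nil (x : ℕ → R) : evalTerms x [] = 0 := rfl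

@[simp] theorem evalTerms_cons (x : ℕ → R) (t : ℤ × List ℕ) (l : List (ℤ × List ℕ)) :
    evalTerms x (t :: l) = t.1 * (t.2.map x).prod + evalTerms x l := by
  simp [evalTerms]

@[simp] theorem evalTerms_append (x : ℕ → R) (l m : List (ℤ × List ℕ)) :
    evalTerms x (l ++ m) = evalTerms x l + evalTerms x m := by
  simp [evalTerms]

/-- The list of the variables occurring in a list of terms. -/
def varsTerms (l : List (ℤ × List ℕ)) : List ℕ := l.flatMap Prod.snd

theorem evalTerms_congr {x y : ℕ → R} {l : List (ℤ × List ℕ)} (h : ∀ i ∈ varsTerms l, x i = y i) :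
    evalTerms x l = evalTerms y l := by
  unfold evalTerms
  congr 1
  apply List.map_congr_left
  intro t ht
  congr 2
  apply List.map_congr_left
  intro i hi
  exact h i (List.mem_flatMap.2 ⟨t, ht, hi⟩)

/-- Multiplication of polynomials on lists of terms. -/
def mulTerms (l m : List (ℤ × List ℕ)) : List (ℤ × List ℕ) :=
  l.flatMap fun t => m.map fun u => (t.1 * u.1, t.2 ++ u.2)

@[simp] theorem evalTerms_mul (x : ℕ → R) (l m : List (ℤ × List ℕ)) :
    evalTerms x (mulTerms l m) = evalTerms x l * evalTerms x m := by
  have h : ∀ t : ℤ × List ℕ, evalTerms x (m.map fun u => (t.1 * u.1, t.2 ++ u.2)) =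
      t.1 * (t.2.map x).prod * evalTerms x m := by
    intro t
    induction m with
    | nil => simp
    | cons u m ih =>
      simp only [List.map_cons, evalTerms_cons, ih, List.map_append, List.prod_append]
      push_cast
      ring
  induction l with
  | nil => simp [mulTerms]
  | cons t l ih =>
    have e : mulTerms (t :: l) m = (m.map fun u => (t.1 * u.1, t.2 ++ u.2)) ++ mulTerms l m := rfl
    rw [e, evalTerms_append, h, ih, evalTerms_cons]
    ring

/-- Renaming of variables on lists of terms. -/
def renameTerms (f : ℕ → ℕ) (l : List (ℤ × List ℕ)) : List (ℤ × List ℕ) :=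
  l.map fun t => (t.1, t.2.map f)

@[simp] theorem evalTerms_rename (x : ℕ → R) (f : ℕ → ℕ) (l : List (ℤ × List ℕ)) :
    evalTerms x (renameTerms f l) = evalTerms (fun i => x (f i)) l := by
  simp [evalTerms, renameTerms, Function.comp_def]

/-- A homogenization: the variable `X i` becomes `X (i + 5)`, and `X 0` is the new variable. -/
def homTerms (l : List (ℤ × List ℕ)) : List (ℤ × List ℕ) :=
  l.map fun t => (t.1, t.2.map (· + 5) ++
    List.replicate ((varsTerms l).length - t.2.length) 0)

theorem evalTerms_hom {x y : ℕ → R} {l : List (ℤ × List ℕ)}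
    (h : ∀ i ∈ varsTerms l, y (i + 5) = y 0 * x i) :
    evalTerms y (homTerms l) = y 0 ^ (varsTerms l).length * evalTerms x l := by
  simp only [evalTerms, homTerms, List.map_map, ← List.sum_map_mul_left]
  congr 1
  apply List.map_congr_left
  intro t ht
  have hsub : ∀ i ∈ t.2, i ∈ varsTerms l := fun i hi => List.mem_flatMap.2 ⟨t, ht, hi⟩
  have hlen : t.2.length ≤ (varsTerms l).length := by
    rw [varsTerms, List.length_flatMap]
    exact List.le_sum_of_mem (List.mem_map.2 ⟨t, ht, rfl⟩)
  have e : ∀ m : List ℕ, (∀ i ∈ m, i ∈ varsTerms l) →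
      (m.map fun i => y (i + 5)).prod = y 0 ^ m.length * (m.map x).prod := by
    intro m hm
    induction m with
    | nil => simp
    | cons i m ih =>
      simp only [List.map_cons, List.prod_cons, List.length_cons]
      rw [ih fun j hj => hm j (List.mem_cons_of_mem _ hj), h i (hm i List.mem_cons_self)]
      ring
  simp only [Function.comp_def, List.map_append, List.map_map, List.prod_append, e t.2 hsub,
    List.map_replicate, List.prod_replicate]
  obtain ⟨k, hk⟩ := Nat.exists_eq_add_of_le hlen
  rw [hk, Nat.add_sub_cancel_left]
  ring

end evalTerms

/-! ### Polynomial reductions between ℚ and its subrings -/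

/-- A list of terms that has a zero over a given subring of `ℚ` if and only if `l` has a zero
over `ℚ`. -/
def clearDenTerms (l : List (ℤ × List ℕ)) : List (ℤ × List ℕ) :=
  let D := [(1, [0]), (-1, []), (-1, [1, 1]), (-1, [2, 2]), (-1, [3, 3]), (-1, [4, 4])]
  mulTerms (homTerms l) (homTerms l) ++ mulTerms D D

/-- The second square forces `X₀ = 1 + X₁² + X₂² + X₃² + X₄²`. This is never zero over `ℚ`, so one
may dehomogenize; by Lagrange's four-square theorem it takes every positive integer value, so `X₀`
can be any common denominator. -/
theorem exists_zero_clearDenTerms_iff (R : Subring ℚ) (l : List (ℤ × List ℕ)) :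
    (∃ y : ℕ → R, evalTerms y (clearDenTerms l) = 0) ↔ ∃ x : ℕ → ℚ, evalTerms x l = 0 := by
  constructor
  · rintro ⟨y, hy⟩
    have h := map_evalTerms R.subtype y (clearDenTerms l)
    rw [hy, map_zero] at h
    set z : ℕ → ℚ := fun i => R.subtype (y i)
    simp only [clearDenTerms, evalTerms_append, evalTerms_mul] at h
    obtain ⟨h1, h2⟩ := (add_eq_zero_iff_of_nonneg (mul_self_nonneg _) (mul_self_nonneg _)).1 h.symm
    rw [mul_self_eq_zero] at h1 h2
    simp only [evalTerms_cons, evalTerms_nil, List.map_cons, List.map_nil, List.prod_cons,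
      List.prod_nil] at h2
    push_cast at h2
    have h0 : z 0 ≠ 0 := by
      have : z 0 = 1 + z 1 ^ 2 + z 2 ^ 2 + z 3 ^ 2 + z 4 ^ 2 := by linear_combination h2
      rw [this]
      positivity
    refine ⟨fun i => z (i + 5) / z 0, ?_⟩
    rw [evalTerms_hom (x := fun i => z (i + 5) / z 0) (fun i _ => by field_simp)] at h1
    simpa [h0] using h1
  · rintro ⟨x, hx⟩
    obtain ⟨d, a, hd, ha, -, -⟩ := exists_common_den (varsTerms l) x
    obtain ⟨k, rfl⟩ := Nat.exists_eq_succ_of_ne_zero hd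
    obtain ⟨s, t, u, v, hk⟩ := Nat.sum_four_squares k
    let y : ℕ → ℤ := fun i => match i with
      | 0 => k + 1
      | 1 => s
      | 2 => t
      | 3 => u
      | 4 => v
      | i + 5 => a i
    have hy : evalTerms y (clearDenTerms l) = 0 := by
      have h1 : evalTerms y (homTerms l) = 0 := by
        apply Int.cast_injective (α := ℚ)
        have := map_evalTerms (Int.castRingHom ℚ) y (homTerms l)
        simp only [eq_intCast] at this
        rw [this, evalTerms_hom (x := x), hx]
        · simp
        · intro i hi
          simp only [y, ha i hi]
          push_cast
          ring
      simp only [clearDenTerms, evalTerms_append, evalTerms_mul, h1]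
      simp only [evalTerms_cons, evalTerms_nil, List.map_cons, List.map_nil, List.prod_cons, List.prod_nil, y, ← hk]
      push_cast
      ring
    refine ⟨fun i => (y i : R), ?_⟩
    have := map_evalTerms (Int.castRingHom R) y (clearDenTerms l)
    rw [hy, map_zero] at this
    exact this.symm

/-- `c` codes a positive integer `d` prime to `2` and the elements of `A` (if there are any), and a
zero of `l` with common denominator `d`. -/
def CodesZero (l : List (ℤ × List ℕ)) (A : List ℕ) (c : ℕ) : Prop :=
  c.unpair.1 ≠ 0 ∧ (∀ p ∈ A, ¬ 2 ∣ c.unpair.1 ∧ ¬ p ∣ c.unpair.1) ∧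
    evalTerms (fun i => ((c.unpair.1 : ℤ) :: Denumerable.ofNat (List ℤ) c.unpair.2).getD i 0)
      (homTerms l) = 0

theorem CodesZero.exists_zero {l : List (ℤ × List ℕ)} {A : List ℕ} {c : ℕ} (h : CodesZero l A c) :
    ∃ x : ℕ → ℚ, evalTerms x l = 0 ∧ ∀ i, (x i).den ∣ c.unpair.1 := by
  obtain ⟨h0, -, h⟩ := h
  have h0' : (c.unpair.1 : ℚ) ≠ 0 := by exact_mod_cast h0
  set y : ℕ → ℤ := fun i => ((c.unpair.1 : ℤ) :: Denumerable.ofNat (List ℤ) c.unpair.2).getD i 0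
    with hy
  have hy0 : y 0 = c.unpair.1 := rfl
  refine ⟨fun i => y (i + 5) / c.unpair.1, ?_, fun i => ?_⟩
  · have := map_evalTerms (Int.castRingHom ℚ) y (homTerms l)
    rw [h, map_zero, evalTerms_hom (x := fun i => (y (i + 5) / c.unpair.1 : ℚ))] at this
    · simpa [hy0, h0'] using this
    · intro i _
      simp only [eq_intCast, hy0, Int.cast_natCast]
      field_simp
  · have := Rat.den_dvd (y (i + 5)) c.unpair.1
    rw [Rat.divInt_eq_div] at this
    exact_mod_cast this

theorem exists_codesZero_iff {l : List (ℤ × List ℕ)} {A : List ℕ} (hA : ∀ p ∈ A, p.Prime) :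
    (∃ c, CodesZero l A c) ↔ ∃ x : ℕ → ℚ, evalTerms x l = 0 ∧
      ∀ i, ∀ p ∈ A, ¬ 2 ∣ (x i).den ∧ ¬ p ∣ (x i).den := by
  constructor
  · rintro ⟨c, h⟩
    obtain ⟨x, hx, hd⟩ := h.exists_zero
    exact ⟨x, hx, fun i p hp => ⟨fun h2 => (h.2.1 p hp).1 (h2.trans (hd i)),
      fun h2 => (h.2.1 p hp).2 (h2.trans (hd i))⟩⟩
  · rintro ⟨x, hx, hden⟩
    obtain ⟨d, a, hd, ha, ha0, hq⟩ := exists_common_den (varsTerms l) x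
    -- Position `0` of the coded list holds `d`, and `homTerms` starts its shifted variables at `5`;
    -- hence four padding zeros.
    let y : ℕ → ℤ := fun i => if i < 4 then 0 else a (i - 4)
    let m : List ℤ := (List.range ((varsTerms l).sum + 5)).map y
    have hm : ∀ i, ((d : ℤ) :: m).getD (i + 5) 0 = a i := by
      intro i
      simp only [List.getD_cons_succ, m]
      by_cases hi : i + 4 < (varsTerms l).sum + 5
      · simp [List.getD_eq_getElem?_getD, hi, y]
      · rw [ha0]
        · simp [List.getD_eq_getElem?_getD, hi]
        · intro hmem
          have := List.le_sum_of_mem hmem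
          omega
    refine ⟨Nat.pair d (Encodable.encode m), ?_, ?_, ?_⟩
    · simpa using hd
    · intro p hp
      simp only [Nat.unpair_pair]
      constructor
      · intro h2
        obtain ⟨i, -, hi⟩ := hq 2 Nat.prime_two h2
        exact (hden i p hp).1 hi
      · intro h2
        obtain ⟨i, -, hi⟩ := hq p (hA p hp) h2
        exact (hden i p hp).2 hi
    · simp only [Nat.unpair_pair, Denumerable.ofNat_encode]
      apply Int.cast_injective (α := ℚ)
      have := map_evalTerms (Int.castRingHom ℚ) (fun i => ((d : ℤ) :: m).getD i 0) (homTerms l)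
      simp only [eq_intCast] at this
      rw [this, evalTerms_hom (x := x), hx]
      · simp
      · intro i hi
        simp only [hm, ha i hi]
        simp

/-- The terms of a polynomial in the variables with the given indices; it has a zero with given
value of `X x` if and only if that value is integral at `2` and `p`. -/
def integralityTerms (p x z u v : ℕ) : List (ℤ × List ℕ) :=
  mulTerms [(2, []), (p, [x, x]), (p, [z, z]), (-1, [u, u]), (-1, [v, v])]
    [(2, []), (p, [x, x]), (2 * p, [x]), (p, []), (p, [z, z]), (-1, [u, u]), (-1, [v, v])]

theorem evalTerms_integralityTerms {R : Type*} [CommRing R] (y : ℕ → R) (p x z u v : ℕ) :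
    evalTerms y (integralityTerms p x z u v) =
      (2 + p * (y x ^ 2 + y z ^ 2) - (y u ^ 2 + y v ^ 2)) *
      (2 + p * ((y x + 1) ^ 2 + y z ^ 2) - (y u ^ 2 + y v ^ 2)) := by
  simp only [integralityTerms, evalTerms_mul, evalTerms_cons, evalTerms_nil, List.map_cons,
    List.map_nil, List.prod_cons, List.prod_nil]
  push_cast
  ring

/-- Terms of a polynomial that has a zero over `ℚ` if and only if `l` has a zero over the ring of
rational numbers that are integral at `2` and the primes in `A`. -/
def localizeTerms (A : List ℕ) (l : List (ℤ × List ℕ)) : List (ℤ × List ℕ) :=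
  mulTerms (renameTerms (Nat.pair 0) l) (renameTerms (Nat.pair 0) l) ++
  A.flatMap fun p => (varsTerms l).flatMap fun i =>
    let T := integralityTerms p (Nat.pair 0 i) (Nat.pair 1 (Nat.pair p i))
      (Nat.pair 2 (Nat.pair p i)) (Nat.pair 3 (Nat.pair p i))
    mulTerms T T

theorem evalTerms_flatMap_nonneg_and {α : Type*} (x : ℕ → ℚ) (L : List α)
    (f : α → List (ℤ × List ℕ)) (h : ∀ a ∈ L, 0 ≤ evalTerms x (f a)) :
    0 ≤ evalTerms x (L.flatMap f) ∧
      (evalTerms x (L.flatMap f) = 0 ↔ ∀ a ∈ L, evalTerms x (f a) = 0) := by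
  induction L with
  | nil => simp
  | cons a L ih =>
    obtain ⟨h1, h2⟩ := ih fun b hb => h b (List.mem_cons_of_mem _ hb)
    have h3 := h a List.mem_cons_self
    rw [List.flatMap_cons, evalTerms_append]
    refine ⟨by positivity, ?_⟩
    rw [add_eq_zero_iff_of_nonneg h3 h1, h2]
    simp

theorem evalTerms_localizeTerms_eq_zero_iff (y : ℕ → ℚ) (A : List ℕ) (l : List (ℤ × List ℕ)) :
    evalTerms y (localizeTerms A l) = 0 ↔ evalTerms (fun i => y (Nat.pair 0 i)) l = 0 ∧
      ∀ p ∈ A, ∀ i ∈ varsTerms l, evalTerms y (integralityTerms p (Nat.pair 0 i)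
        (Nat.pair 1 (Nat.pair p i)) (Nat.pair 2 (Nat.pair p i)) (Nat.pair 3 (Nat.pair p i))) = 0 := by
  simp only [localizeTerms, evalTerms_append]
  have h1 := fun p : ℕ => evalTerms_flatMap_nonneg_and y (varsTerms l) (fun i =>
    mulTerms (integralityTerms p (Nat.pair 0 i) (Nat.pair 1 (Nat.pair p i))
      (Nat.pair 2 (Nat.pair p i)) (Nat.pair 3 (Nat.pair p i)))
      (integralityTerms p (Nat.pair 0 i) (Nat.pair 1 (Nat.pair p i))
      (Nat.pair 2 (Nat.pair p i)) (Nat.pair 3 (Nat.pair p i))))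
    (fun i _ => by rw [evalTerms_mul]; exact mul_self_nonneg _)
  have h2 := evalTerms_flatMap_nonneg_and y A _ fun p _ => (h1 p).1
  rw [add_eq_zero_iff_of_nonneg (by rw [evalTerms_mul]; exact mul_self_nonneg _) h2.1, h2.2]
  refine and_congr (by simp) (forall₂_congr fun p _ => ?_)
  rw [(h1 p).2]
  simp

/-- Over `ℚ` a sum of squares vanishes only if each term does, so one polynomial expresses the whole
system. Each pair of a prime and a variable has its own auxiliary `z, u, v`, so the integrality
conditions do not interfere. Variables absent from `l` are reset to `0`. -/
theorem exists_zero_localizeTerms_iff {A : List ℕ} (hA : ∀ p ∈ A, p.Prime ∧ p % 4 = 3)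
    (l : List (ℤ × List ℕ)) :
    (∃ y : ℕ → ℚ, evalTerms y (localizeTerms A l) = 0) ↔ ∃ x : ℕ → ℚ, evalTerms x l = 0 ∧
      ∀ i, ∀ p ∈ A, ¬ 2 ∣ (x i).den ∧ ¬ p ∣ (x i).den := by
  simp only [evalTerms_localizeTerms_eq_zero_iff, evalTerms_integralityTerms]
  constructor
  · rintro ⟨y, hy, h⟩
    refine ⟨fun i => if i ∈ varsTerms l then y (Nat.pair 0 i) else 0, ?_, fun i p hp => ?_⟩
    · rw [← hy]
      exact evalTerms_congr fun i hi => by simp [hi]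
    · by_cases hi : i ∈ varsTerms l
      · simp only [hi, if_true]
        exact (exists_two_add_iff_not_dvd_den (hA p hp).1 (hA p hp).2 _).1 ⟨_, _, _, h p hp i hi⟩
      · simpa [hi] using (hA p hp).1.one_lt.ne'
  · rintro ⟨x, hx, h⟩
    have h' : ∀ p i, ∃ z u v : ℚ, p ∈ A → (2 + p * (x i ^ 2 + z ^ 2) - (u ^ 2 + v ^ 2)) *
        (2 + p * ((x i + 1) ^ 2 + z ^ 2) - (u ^ 2 + v ^ 2)) = 0 := by
      intro p i
      by_cases hp : p ∈ A
      · obtain ⟨z, u, v, e⟩ :=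
          (exists_two_add_iff_not_dvd_den (hA p hp).1 (hA p hp).2 (x i)).2 (h i p hp)
        exact ⟨z, u, v, fun _ => e⟩
      · exact ⟨0, 0, 0, fun hp' => absurd hp' hp⟩
    choose z u v hzuv using h'
    refine ⟨fun n => match n.unpair.1 with
      | 0 => x n.unpair.2
      | 1 => z n.unpair.2.unpair.1 n.unpair.2.unpair.2
      | 2 => u n.unpair.2.unpair.1 n.unpair.2.unpair.2
      | _ => v n.unpair.2.unpair.1 n.unpair.2.unpair.2, ?_, fun p hp i _ => ?_⟩
    · simpa using hx
    · simpa only [Nat.unpair_pair] using hzuv p i hp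

/-! ### Primitive recursiveness of the polynomial operations -/

theorem Primrec.int_ofNat : Primrec (fun n : ℕ => (n : ℤ)) :=
  Primrec.encode_iff.1 (Primrec.nat_double.of_eq fun _ => rfl)

theorem Primrec.int_negSucc : Primrec Int.negSucc :=
  Primrec.encode_iff.1 (Primrec.nat_double_succ.of_eq fun _ => rfl)

/-- In the numbering of `ℤ` the nonnegative integers have even codes and the negative ones odd
codes, so the parity of the code selects the summand. -/
theorem Primrec.intEquivNatSumNat : Primrec Equiv.intEquivNatSumNat := by
  refine Primrec.ofNat_iff.2 ((Primrec.cond Primrec.nat_bodd (Primrec.sumInr.comp Primrec.nat_div2)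
    (Primrec.sumInl.comp Primrec.nat_div2)).of_eq fun n => ?_)
  have h : ∀ z : ℤ, _root_.cond (Encodable.encode z).bodd
      (Sum.inr (Encodable.encode z).div2 : ℕ ⊕ ℕ) (Sum.inl (Encodable.encode z).div2) =
      Equiv.intEquivNatSumNat z := by
    rintro (m | m)
    · have : Encodable.encode (Int.ofNat m) = 2 * m := rfl
      simp only [this, Nat.div2_val, Nat.mul_div_cancel_left m two_pos]
      simp
      rfl
    · have : Encodable.encode (Int.negSucc m) = 2 * m + 1 := rfl
      have e : (2 * m + 1) / 2 = m := by omega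
      simp only [this, Nat.div2_val, e]
      simp
      rfl
  have := h (Denumerable.ofNat ℤ n)
  rwa [Denumerable.encode_ofNat] at this

theorem Primrec.int_toNat : Primrec Int.toNat :=
  (Primrec.sumCasesOn (g := fun _ n => n) (h := fun _ _ => 0) Primrec.intEquivNatSumNat
    Primrec.snd.to₂ (Primrec.const 0).to₂).of_eq <| by rintro (m | m) <;> rfl

theorem Primrec.int_neg_toNat : Primrec (fun z : ℤ => (-z).toNat) :=
  (Primrec.sumCasesOn (g := fun _ _ => 0) (h := fun _ n => n + 1) Primrec.intEquivNatSumNat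
    (Primrec.const 0).to₂ (Primrec.succ.comp Primrec.snd).to₂).of_eq <| by
      rintro (m | m)
      · change 0 = (-(m : ℤ)).toNat
        simp
      · rfl

theorem Primrec.int_natSub : Primrec₂ (fun m n : ℕ => (m : ℤ) - n) :=
  (Primrec.ite (Primrec.nat_le.comp Primrec.snd Primrec.fst)
    (Primrec.int_ofNat.comp (Primrec.nat_sub.comp Primrec.fst Primrec.snd))
    (Primrec.int_negSucc.comp (Primrec.pred.comp
      (Primrec.nat_sub.comp Primrec.snd Primrec.fst)))).of_eq fun ⟨m, n⟩ => by
        dsimp only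
        split_ifs with h
        · omega
        · rw [Int.negSucc_eq]
          simp only [Nat.pred_eq_sub_one]
          omega

theorem Primrec.int_add : Primrec₂ (fun a b : ℤ => a + b) :=
  (Primrec.int_natSub.comp
    (Primrec.nat_add.comp (Primrec.int_toNat.comp Primrec.fst) (Primrec.int_toNat.comp Primrec.snd))
    (Primrec.nat_add.comp (Primrec.int_neg_toNat.comp Primrec.fst)
      (Primrec.int_neg_toNat.comp Primrec.snd))).of_eq fun ⟨a, b⟩ => by
        push_cast
        omega

theorem Primrec.int_mul : Primrec₂ (fun a b : ℤ => a * b) :=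
  have ap := Primrec.int_toNat.comp (Primrec.fst (α := ℤ) (β := ℤ))
  have bp := Primrec.int_toNat.comp (Primrec.snd (α := ℤ) (β := ℤ))
  have an := Primrec.int_neg_toNat.comp (Primrec.fst (α := ℤ) (β := ℤ))
  have bn := Primrec.int_neg_toNat.comp (Primrec.snd (α := ℤ) (β := ℤ))
  (Primrec.int_natSub.comp
    (Primrec.nat_add.comp (Primrec.nat_mul.comp ap bp) (Primrec.nat_mul.comp an bn))
    (Primrec.nat_add.comp (Primrec.nat_mul.comp ap bn) (Primrec.nat_mul.comp an bp))).of_eq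
      fun ⟨a, b⟩ => by
        -- Both factors are written as differences of natural numbers and the product is expanded.
        have h : ∀ z : ℤ, (z.toNat : ℤ) - (-z).toNat = z := fun z => by omega
        push_cast
        nth_rewrite 5 [← h a]
        nth_rewrite 5 [← h b]
        ring

theorem Primrec.list_int_sum : Primrec (List.sum : List ℤ → ℤ) :=
  (Primrec.list_foldr Primrec.id (Primrec.const 0)
    (Primrec.int_add.comp (Primrec.fst.comp Primrec.snd) (Primrec.snd.comp Primrec.snd)).to₂).of_eq
      fun l => by simp [List.sum]

theorem Primrec.list_int_prod : Primrec (List.prod : List ℤ → ℤ) :=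
  (Primrec.list_foldr Primrec.id (Primrec.const 1)
    (Primrec.int_mul.comp (Primrec.fst.comp Primrec.snd) (Primrec.snd.comp Primrec.snd)).to₂).of_eq
      fun l => by simp [List.prod]

theorem Primrec.list_replicate {α : Type*} [Primcodable α] :
    Primrec₂ (fun (n : ℕ) (a : α) => List.replicate n a) :=
  (Primrec.list_map (Primrec.list_range.comp Primrec.fst)
    (Primrec.snd.comp Primrec.fst).to₂).of_eq fun ⟨n, a⟩ => by simp

theorem PrimrecPred.nat_prime : PrimrecPred Nat.Prime := by
  have h : PrimrecRel fun m p : ℕ => p % m = 0 → m = 1 :=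
    ((Primrec.eq.comp (Primrec.nat_mod.comp Primrec.snd Primrec.fst) (Primrec.const 0)).not.or
      (Primrec.eq.comp Primrec.fst (Primrec.const 1))).of_eq fun ⟨m, p⟩ => by
        dsimp only
        tauto
  refine ((Primrec.nat_le.comp (Primrec.const 2) Primrec.id).and
    (h.forall_lt.comp Primrec.id Primrec.id)).of_eq fun p => ?_
  simp only [id, ← Nat.dvd_iff_mod_eq_zero]
  exact Nat.prime_def_lt.symm

theorem primrec_mulTerms : Primrec₂ mulTerms :=
  Primrec.list_flatMap Primrec.fst (Primrec.list_map (Primrec.snd.comp Primrec.fst)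
    (Primrec.pair
      (Primrec.int_mul.comp (Primrec.fst.comp (Primrec.snd.comp Primrec.fst))
        (Primrec.fst.comp Primrec.snd))
      (Primrec.list_append.comp (Primrec.snd.comp (Primrec.snd.comp Primrec.fst))
        (Primrec.snd.comp Primrec.snd))).to₂).to₂

theorem primrec_varsTerms : Primrec varsTerms :=
  Primrec.list_flatMap Primrec.id (Primrec.snd.comp Primrec.snd).to₂

theorem primrec_renameTerms {f : ℕ → ℕ} (hf : Primrec f) : Primrec (renameTerms f) :=
  Primrec.list_map Primrec.id (Primrec.pair (Primrec.fst.comp Primrec.snd)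
    (Primrec.list_map (Primrec.snd.comp Primrec.snd) (hf.comp Primrec.snd).to₂)).to₂

theorem primrec_homTerms : Primrec homTerms :=
  Primrec.list_map Primrec.id (Primrec.pair (Primrec.fst.comp Primrec.snd)
    (Primrec.list_append.comp
      (Primrec.list_map (Primrec.snd.comp Primrec.snd)
        (Primrec.nat_add.comp Primrec.snd (Primrec.const 5)).to₂)
      (Primrec.list_replicate.comp
        (Primrec.nat_sub.comp (Primrec.list_length.comp (primrec_varsTerms.comp Primrec.fst))
          (Primrec.list_length.comp (Primrec.snd.comp Primrec.snd))) (Primrec.const 0)))).to₂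

theorem primrec_clearDenTerms : Primrec clearDenTerms :=
  Primrec.list_append.comp (primrec_mulTerms.comp primrec_homTerms primrec_homTerms)
    (Primrec.const _)

theorem primrec_evalTerms_list : Primrec₂ fun (a : List ℤ) (l : List (ℤ × List ℕ)) =>
    evalTerms (fun i => a.getD i 0) l :=
  (Primrec.list_int_sum.comp (Primrec.list_map Primrec.snd
    (Primrec.int_mul.comp (Primrec.fst.comp Primrec.snd)
      (Primrec.list_int_prod.comp (Primrec.list_map (Primrec.snd.comp Primrec.snd)
        ((Primrec.list_getD 0).comp (Primrec.fst.comp (Primrec.fst.comp Primrec.fst))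
          Primrec.snd).to₂))).to₂)).of_eq fun _ => rfl

theorem primrec_integralityTerms {α : Type*} [Primcodable α] {p x z u v : α → ℕ} (hp : Primrec p)
    (hx : Primrec x) (hz : Primrec z) (hu : Primrec u) (hv : Primrec v) :
    Primrec fun a => integralityTerms (p a) (x a) (z a) (u a) (v a) := by
  have hp' : Primrec fun a => (p a : ℤ) := Primrec.int_ofNat.comp hp
  have h1 : ∀ {y : α → ℕ}, Primrec y → Primrec fun a => [y a] := fun hy =>
    Primrec.list_cons.comp hy (Primrec.const [])
  have h2 : ∀ {y : α → ℕ}, Primrec y → Primrec fun a => [y a, y a] := fun hy =>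
    Primrec.list_cons.comp hy (h1 hy)
  refine primrec_mulTerms.comp ?_ ?_
  · exact Primrec.list_cons.comp (Primrec.const _) <| Primrec.list_cons.comp (hp'.pair (h2 hx)) <|
      Primrec.list_cons.comp (hp'.pair (h2 hz)) <|
      Primrec.list_cons.comp ((Primrec.const _).pair (h2 hu)) <|
      Primrec.list_cons.comp ((Primrec.const _).pair (h2 hv)) <| Primrec.const _
  · exact Primrec.list_cons.comp (Primrec.const _) <| Primrec.list_cons.comp (hp'.pair (h2 hx)) <|
      Primrec.list_cons.comp ((Primrec.int_mul.comp (Primrec.const 2) hp').pair (h1 hx)) <|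
      Primrec.list_cons.comp (hp'.pair (Primrec.const _)) <|
      Primrec.list_cons.comp (hp'.pair (h2 hz)) <|
      Primrec.list_cons.comp ((Primrec.const _).pair (h2 hu)) <|
      Primrec.list_cons.comp ((Primrec.const _).pair (h2 hv)) <| Primrec.const _

theorem primrec_localizeTerms : Primrec₂ localizeTerms := by
  have hren : Primrec (renameTerms (Nat.pair 0)) :=
    primrec_renameTerms (Primrec₂.natPair.comp (Primrec.const 0) Primrec.id)
  refine Primrec.list_append.comp
    (primrec_mulTerms.comp (hren.comp Primrec.snd) (hren.comp Primrec.snd)) ?_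
  have hk : ∀ k : ℕ, Primrec fun q : ((List ℕ × List (ℤ × List ℕ)) × ℕ) × ℕ =>
      Nat.pair k (Nat.pair q.1.2 q.2) := fun k =>
    Primrec₂.natPair.comp (Primrec.const k)
      (Primrec₂.natPair.comp (Primrec.snd.comp Primrec.fst) Primrec.snd)
  have := primrec_integralityTerms (Primrec.snd.comp Primrec.fst)
    (Primrec₂.natPair.comp (Primrec.const 0) Primrec.snd) (hk 1) (hk 2) (hk 3)
  have h := Primrec.list_flatMap (f := fun r : (List ℕ × List (ℤ × List ℕ)) × ℕ => varsTerms r.1.2)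
    (primrec_varsTerms.comp (Primrec.snd.comp Primrec.fst)) (primrec_mulTerms.comp this this).to₂
  exact Primrec.list_flatMap Primrec.fst h.to₂

theorem Primrec.list_ofNat {α : Type*} [Denumerable α] : Primrec (Denumerable.ofNat (List α)) :=
  Primrec.option_some_iff.1 (Primrec.decode.of_eq fun n => by simp)

theorem primrecPred_codesZero :
    PrimrecPred fun q : (List (ℤ × List ℕ) × List ℕ) × ℕ => CodesZero q.1.1 q.1.2 q.2 := by
  have hd : Primrec fun q : (List (ℤ × List ℕ) × List ℕ) × ℕ => q.2.unpair.1 :=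
    Primrec.fst.comp (Primrec.unpair.comp Primrec.snd)
  have hR : PrimrecRel fun p d : ℕ => ¬ 2 ∣ d ∧ ¬ p ∣ d :=
    ((Primrec.eq.comp (Primrec.nat_mod.comp Primrec.snd (Primrec.const 2)) (Primrec.const 0)).not.and
      (Primrec.eq.comp (Primrec.nat_mod.comp Primrec.snd Primrec.fst) (Primrec.const 0)).not).of_eq
        fun ⟨p, d⟩ => by simp [Nat.dvd_iff_mod_eq_zero]
  refine (Primrec.eq.comp hd (Primrec.const 0)).not.and ((hR.forall_mem_list.comp
    (Primrec.snd.comp Primrec.fst) hd).and (Primrec.eq.comp (primrec_evalTerms_list.comp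
      (Primrec.list_cons.comp (Primrec.int_ofNat.comp hd) (Primrec.list_ofNat.comp
        (Primrec.snd.comp (Primrec.unpair.comp Primrec.snd))))
      (primrec_homTerms.comp (Primrec.fst.comp Primrec.fst))) (Primrec.const 0)))

/-! ### Sequences of protected primes -/

theorem exists_prime_gt_mod_four_eq_three (n : ℕ) : ∃ q, n < q ∧ q.Prime ∧ q % 4 = 3 := by
  obtain ⟨q, h1, h2, h3⟩ := Nat.forall_exists_prime_gt_and_modEq n (q := 4) (a := 3) (by norm_num)
    (by norm_num)
  exact ⟨q, h1, h2, h3⟩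

open Classical in
/-- The least prime `q ≡ 3 mod 4` with `n < q`. -/
noncomputable def nextPrime (n : ℕ) : ℕ := Nat.find (exists_prime_gt_mod_four_eq_three n)

theorem nextPrime_spec (n : ℕ) : n < nextPrime n ∧ (nextPrime n).Prime ∧ nextPrime n % 4 = 3 := by
  classical exact Nat.find_spec (exists_prime_gt_mod_four_eq_three n)

theorem nextPrime_le {n q : ℕ} (h : n < q) (hq : q.Prime) (hq4 : q % 4 = 3) : nextPrime n ≤ q := by
  classical exact Nat.find_min' (exists_prime_gt_mod_four_eq_three n) ⟨h, hq, hq4⟩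

theorem computable_nextPrime : Computable nextPrime := by
  classical
  have h : PrimrecPred fun p : ℕ × ℕ => p.1 < p.2 ∧ p.2.Prime ∧ p.2 % 4 = 3 :=
    (Primrec.nat_lt.comp Primrec.fst Primrec.snd).and ((PrimrecPred.nat_prime.comp Primrec.snd).and
      (Primrec.eq.comp (Primrec.nat_mod.comp Primrec.snd (Primrec.const 4)) (Primrec.const 3)))
  exact Computable.find (P := fun n q => n < q ∧ q.Prime ∧ q % 4 = 3) h.computablePred _

/-- Prepend to `A` the next admissible prime that exceeds the head of `A` and `c`. -/
noncomputable def extendPrimes (A : List ℕ) (c : ℕ) : List ℕ := nextPrime (max A.headI c) :: A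

theorem computable_extendPrimes : Computable₂ extendPrimes :=
  Computable.list_cons.comp (computable_nextPrime.comp (Primrec.nat_max.to_comp.comp
    (Primrec.list_headI.to_comp.comp Computable.fst) Computable.snd)) Computable.fst

/-- The descending lists of primes obtained from `[3]` by repeatedly adding a prime that exceeds a
bound given by `c`. -/
noncomputable def primePath (c : List ℕ → ℕ → ℕ) : ℕ → List ℕ
  | 0 => [3]
  | e + 1 => extendPrimes (primePath c e) (c (primePath c e) e)

section primePath

variable {c : List ℕ → ℕ → ℕ}

theorem prime_of_mem_primePath {e p : ℕ} (h : p ∈ primePath c e) : p.Prime ∧ p % 4 = 3 := by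
  induction e with
  | zero =>
    rw [primePath, List.mem_singleton] at h
    subst h
    exact ⟨Nat.prime_three, rfl⟩
  | succ e ih =>
    rcases List.mem_cons.1 h with rfl | h
    · exact (nextPrime_spec _).2
    · exact ih h

theorem lt_headI_primePath_succ (c : List ℕ → ℕ → ℕ) (e : ℕ) :
    max (primePath c e).headI (c (primePath c e) e) < (primePath c (e + 1)).headI :=
  (nextPrime_spec _).1

theorem strictMono_headI_primePath (c : List ℕ → ℕ → ℕ) :
    StrictMono fun e => (primePath c e).headI :=
  strictMono_nat_of_lt_succ fun e => (le_max_left _ _).trans_lt (lt_headI_primePath_succ c e)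

theorem le_headI_primePath (c : List ℕ → ℕ → ℕ) (e : ℕ) : e ≤ (primePath c e).headI :=
  (strictMono_headI_primePath c).le_apply

theorem mem_primePath_iff {e p : ℕ} : p ∈ primePath c e ↔ ∃ k ≤ e, (primePath c k).headI = p := by
  induction e with
  | zero => simp [primePath, eq_comm]
  | succ e ih =>
    have : p ∈ primePath c (e + 1) ↔ p = (primePath c (e + 1)).headI ∨ p ∈ primePath c e :=
      List.mem_cons
    rw [this, ih]
    constructor
    · rintro (rfl | ⟨k, hk, rfl⟩)
      · exact ⟨e + 1, le_rfl, rfl⟩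
      · exact ⟨k, by omega, rfl⟩
    · rintro ⟨k, hk, rfl⟩
      rcases Nat.lt_or_ge e k with h | h
      · left
        rw [show k = e + 1 by omega]
      · exact Or.inr ⟨k, h, rfl⟩

/-- The `e`-th head is at least `e`, so a prime `p` that ever enters the sequence has entered by
step `p`. This bounds the search. -/
theorem mem_primePath_self_iff {p : ℕ} :
    p ∈ primePath c p ↔ p ∈ Set.range fun e => (primePath c e).headI := by
  rw [mem_primePath_iff]
  constructor
  · rintro ⟨k, -, h⟩
    exact ⟨k, h⟩
  · rintro ⟨k, rfl⟩
    exact ⟨k, le_headI_primePath c k, rfl⟩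

/-- Bounds below `s` can make the sequence skip only primes below `s`; from there on it takes every
prime that is `3` mod `4`. -/
theorem mem_range_headI_primePath {s r : ℕ} (hc : ∀ A e, c A e = 0 ∨ c A e < s) (hr : r.Prime)
    (hr4 : r % 4 = 3) (hsr : s ≤ r) : r ∈ Set.range fun e => (primePath c e).headI := by
  classical
  have hex : ∃ e, r ≤ (primePath c e).headI := ⟨r, le_headI_primePath c r⟩
  obtain ⟨e, he, hmin⟩ : ∃ e, r ≤ (primePath c e).headI ∧ ∀ k < e, (primePath c k).headI < r :=
    ⟨Nat.find hex, Nat.find_spec hex, fun k hk => not_le.1 (Nat.find_min hex hk)⟩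
  refine ⟨e, le_antisymm ?_ he⟩
  rcases e with _ | e
  · change 3 ≤ r
    omega
  · refine nextPrime_le (max_lt (hmin e (Nat.lt_succ_self e)) ?_) hr hr4
    rcases hc (primePath c e) e with h | h <;> omega

end primePath

/-! ### Least codes of zeros and their finite-stage approximations -/

open Classical in
/-- The least code of a zero of the `e`-th polynomial over the localization given by `A`, or `0` if
there is none. -/
noncomputable def leastCode (A : List ℕ) (e : ℕ) : ℕ :=
  if h : ∃ c, CodesZero (Denumerable.ofNat _ e) A c then Nat.find h else 0

/-- The alternative `s ≤ c` makes the search for a code terminate even if there is no zero, so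
`leastCodeBelow` is computable without an oracle. -/
theorem exists_codesZero_or_le (s : ℕ) (A : List ℕ) (e : ℕ) :
    ∃ c, CodesZero (Denumerable.ofNat _ e) A c ∨ s ≤ c := ⟨s, Or.inr le_rfl⟩

open Classical in
/-- The least code of a zero as in `leastCode`, if it is less than `s`, and otherwise `0`. -/
noncomputable def leastCodeBelow (s : ℕ) (A : List ℕ) (e : ℕ) : ℕ :=
  if Nat.find (exists_codesZero_or_le s A e) < s then Nat.find (exists_codesZero_or_le s A e) else 0

theorem codesZero_leastCode {A : List ℕ} {e : ℕ}
    (h : ∃ c, CodesZero (Denumerable.ofNat _ e) A c) :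
    CodesZero (Denumerable.ofNat _ e) A (leastCode A e) := by
  classical
  rw [leastCode, dif_pos h]
  exact Nat.find_spec h

theorem leastCodeBelow_eq_zero_or_lt (s : ℕ) (A : List ℕ) (e : ℕ) :
    leastCodeBelow s A e = 0 ∨ leastCodeBelow s A e < s := by
  unfold leastCodeBelow
  split_ifs with h
  · exact Or.inr h
  · exact Or.inl rfl

theorem leastCodeBelow_eq_or_le (s : ℕ) (A : List ℕ) (e : ℕ) :
    leastCodeBelow s A e = leastCode A e ∨ s ≤ leastCode A e := by
  classical
  by_cases h : ∃ c, CodesZero (Denumerable.ofNat _ e) A c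
  · by_cases hs : s ≤ leastCode A e
    · exact Or.inr hs
    · left
      have hle : Nat.find (exists_codesZero_or_le s A e) ≤ leastCode A e :=
        Nat.find_min' _ (Or.inl (codesZero_leastCode h))
      have hlt : Nat.find (exists_codesZero_or_le s A e) < s := hle.trans_lt (not_le.1 hs)
      rw [leastCodeBelow, if_pos hlt]
      refine le_antisymm hle ?_
      rw [leastCode, dif_pos h]
      exact Nat.find_min' h
        ((Nat.find_spec (exists_codesZero_or_le s A e)).resolve_right (not_le.2 hlt))
  · left
    rw [leastCode, dif_neg h, leastCodeBelow, if_neg]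
    rw [not_lt]
    exact (Nat.find_spec (exists_codesZero_or_le s A e)).resolve_left fun h' => h ⟨_, h'⟩

theorem computable_leastCodeBelow :
    Computable fun q : ℕ × List ℕ × ℕ => leastCodeBelow q.1 q.2.1 q.2.2 := by
  classical
  have h : PrimrecPred fun p : (ℕ × List ℕ × ℕ) × ℕ =>
      CodesZero (Denumerable.ofNat _ p.1.2.2) p.1.2.1 p.2 ∨ p.1.1 ≤ p.2 :=
    (primrecPred_codesZero.comp (((Primrec.list_ofNat.comp (Primrec.snd.comp
      (Primrec.snd.comp Primrec.fst))).pair (Primrec.fst.comp (Primrec.snd.comp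
      Primrec.fst))).pair Primrec.snd)).or
      (Primrec.nat_le.comp (Primrec.fst.comp Primrec.fst) Primrec.snd)
  have hfind := Computable.find (α := ℕ × List ℕ × ℕ) (P := fun q c =>
    CodesZero (Denumerable.ofNat _ q.2.2) q.2.1 c ∨ q.1 ≤ c) h.computablePred
    (fun q => exists_codesZero_or_le q.1 q.2.1 q.2.2)
  have hite : Primrec₂ fun m s : ℕ => if m < s then m else 0 :=
    Primrec.ite (Primrec.nat_lt.comp Primrec.fst Primrec.snd) Primrec.fst (Primrec.const 0)
  refine (hite.to_comp.comp hfind Computable.fst).of_eq fun q => ?_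
  simp only [leastCodeBelow]

theorem computable_primePath_leastCodeBelow :
    Computable₂ fun s e : ℕ => primePath (leastCodeBelow s) e := by
  have hstep : Computable₂ fun (q : ℕ × ℕ) (p : ℕ × List ℕ) =>
      extendPrimes p.2 (leastCodeBelow q.1 p.2 p.1) :=
    computable_extendPrimes.comp (Computable.snd.comp Computable.snd)
      (computable_leastCodeBelow.comp
        (g := fun r : (ℕ × ℕ) × ℕ × List ℕ => (r.1.1, r.2.2, r.2.1))
        ((Computable.fst.comp Computable.fst).pair ((Computable.snd.comp Computable.snd).pair (Computable.fst.comp Computable.snd))))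
  refine (Computable.nat_rec Computable.snd (Computable.const [3]) hstep).of_eq fun q => ?_
  obtain ⟨s, e⟩ := q
  dsimp only
  induction e with
  | zero => rfl
  | succ e ih => rw [primePath, ← ih]

/-- Stage `s` can first go wrong at a step whose true least code is at least `s`, and the true
sequence then jumps beyond `s`. -/
theorem primePath_leastCodeBelow_eq_or_le (s e : ℕ) :
    primePath (leastCodeBelow s) e = primePath leastCode e ∨ s ≤ (primePath leastCode e).headI := by
  induction e with
  | zero => exact Or.inl rfl
  | succ e ih =>
    have hlt := lt_headI_primePath_succ leastCode e
    rcases ih with ih | ih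
    · rcases leastCodeBelow_eq_or_le s (primePath leastCode e) e with h | h
      · left
        rw [primePath, primePath, ih, h]
      · exact Or.inr ((h.trans (le_max_right _ _)).trans hlt.le)
    · exact Or.inr ((ih.trans (le_max_left _ _)).trans hlt.le)

/-! ### The set of inverted primes -/

/-- The primes to be inverted: those, other than `2`, that some finite stage excludes from the
sequence of protected primes. -/
def invertedPrimes : Set ℕ :=
  {r | r.Prime ∧ r ≠ 2 ∧ ∃ s, r ∉ primePath (leastCodeBelow s) r}

/-- A truly protected prime is never excluded by a stage `s`: either that stage still agrees with
the true sequence, or the prime is at least `s` and is taken by `mem_range_headI_primePath`. -/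
theorem mem_invertedPrimes_iff {r : ℕ} : r ∈ invertedPrimes ↔
    r.Prime ∧ r ≠ 2 ∧ r ∉ Set.range fun e => (primePath leastCode e).headI := by
  refine and_congr_right fun hr => and_congr_right fun hr2 => ⟨?_, ?_⟩
  · rintro ⟨s, hs⟩ ⟨e, rfl⟩
    apply hs
    rw [mem_primePath_self_iff]
    rcases primePath_leastCodeBelow_eq_or_le s e with h | h
    · exact ⟨e, by simp only [h]⟩
    · refine mem_range_headI_primePath (leastCodeBelow_eq_zero_or_lt s) hr ?_ h
      exact (prime_of_mem_primePath (mem_primePath_iff.2 ⟨e, le_rfl, rfl⟩)).2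
  · intro h
    -- A stage beyond the `r`-th true head agrees with the true sequence through step `r`.
    refine ⟨(primePath leastCode r).headI + 1, ?_⟩
    rw [(primePath_leastCodeBelow_eq_or_le _ r).resolve_right (by omega), mem_primePath_self_iff]
    exact h

theorem infinite_invertedPrimes : invertedPrimes.Infinite := by
  refine Set.infinite_of_forall_exists_gt fun n => ?_
  obtain ⟨q, h1, h2, h3⟩ := Nat.forall_exists_prime_gt_and_modEq n (q := 4) (a := 1) (by norm_num)
    (by norm_num)
  have h3' : q % 4 = 1 := h3
  refine ⟨q, mem_invertedPrimes_iff.2 ⟨h2, by omega, ?_⟩, h1⟩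
  rintro ⟨e, rfl⟩
  have h4 : (primePath leastCode e).headI % 4 = 3 :=
    (prime_of_mem_primePath (mem_primePath_iff.2 ⟨e, le_rfl, rfl⟩)).2
  dsimp only at h3'
  omega

theorem infinite_not_mem_invertedPrimes : {p : ℕ | p.Prime ∧ p ∉ invertedPrimes}.Infinite := by
  refine (Set.infinite_range_of_injective (strictMono_headI_primePath leastCode).injective).mono ?_
  rintro _ ⟨e, rfl⟩
  exact ⟨(prime_of_mem_primePath (mem_primePath_iff.2 ⟨e, le_rfl, rfl⟩)).1,
    fun h => (mem_invertedPrimes_iff.1 h).2.2 ⟨e, rfl⟩⟩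

theorem ComputablePred.comp {α β : Type*} [Primcodable α] [Primcodable β] {p : β → Prop}
    {f : α → β} (hp : ComputablePred p) (hf : Computable f) : ComputablePred fun a => p (f a) := by
  obtain ⟨_, hp⟩ := hp
  exact ⟨inferInstance, hp.comp hf⟩

theorem ComputablePred.exists_nat {α : Type*} [Primcodable α] {P : α → ℕ → Prop}
    (h : ComputablePred fun p : α × ℕ => P p.1 p.2) : REPred fun a => ∃ n, P a n := by
  classical
  have : Partrec fun a => Nat.rfind (fun n => Part.some (decide (P a n)) : ℕ →. Bool) :=
    Partrec.rfind h.decide.partrec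
  refine this.dom_re.of_eq fun a => (Nat.rfind_dom' (p := fun n => Part.some (decide (P a n)))).trans
    ⟨fun ⟨n, hn, _⟩ => ⟨n, ?_⟩, fun ⟨n, hn⟩ => ⟨n, ?_, fun _ => trivial⟩⟩
  · simpa using hn
  · simpa using hn

theorem rePred_invertedPrimes : REPred fun n : ℕ => n ∈ invertedPrimes := by
  classical
  have hmem : PrimrecRel fun (L : List ℕ) (r : ℕ) => r ∈ L :=
    (Primrec.eq.exists_mem_list (α := ℕ)).of_eq fun L r => by simp
  have hP : PrimrecPred fun q : ℕ × List ℕ => q.1.Prime ∧ q.1 ≠ 2 ∧ q.1 ∉ q.2 :=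
    (PrimrecPred.nat_prime.comp Primrec.fst).and
      ((Primrec.eq.comp Primrec.fst (Primrec.const 2)).not.and
        (hmem.comp Primrec.snd Primrec.fst).not)
  have hC : ComputablePred fun p : ℕ × ℕ =>
      p.1.Prime ∧ p.1 ≠ 2 ∧ p.1 ∉ primePath (leastCodeBelow p.2) p.1 :=
    hP.computablePred.comp (f := fun p : ℕ × ℕ => (p.1, primePath (leastCodeBelow p.2) p.1))
      (Computable.fst.pair (computable_primePath_leastCodeBelow.comp Computable.snd Computable.fst))
  refine (ComputablePred.exists_nat (P := fun r s =>
    r.Prime ∧ r ≠ 2 ∧ r ∉ primePath (leastCodeBelow s) r) hC).of_eq fun r => ?_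
  simp [invertedPrimes]

/-! ### The Turing reductions -/

/-- The index of the polynomial that decides over `ℚ` whether the `e`-th polynomial has a zero
over the localization given by `A`. -/
def localizeIndex (A : List ℕ) (e : ℕ) : ℕ :=
  Encodable.encode (localizeTerms A (Denumerable.ofNat _ e))

theorem primrec_localizeIndex : Primrec₂ localizeIndex :=
  Primrec.encode.comp (primrec_localizeTerms.comp Primrec.fst
    (Primrec.list_ofNat.comp Primrec.snd))

theorem localizeIndex_mem_HTP_iff {A : List ℕ} (hA : ∀ p ∈ A, p.Prime ∧ p % 4 = 3) (e : ℕ) :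
    localizeIndex A e ∈ HTP ℚ ↔ ∃ c, CodesZero (Denumerable.ofNat _ e) A c := by
  rw [localizeIndex, encode_mem_HTP_iff, exists_zero_localizeTerms_iff hA,
    exists_codesZero_iff fun p hp => (hA p hp).1]

theorem mem_HTP_invertedPrimes_iff (n : ℕ) : n ∈ HTP (invertPrimes invertedPrimes) ↔
    localizeIndex (primePath leastCode n) n ∈ HTP ℚ := by
  have hA : ∀ p ∈ primePath leastCode n, p.Prime ∧ p % 4 = 3 := fun p => prime_of_mem_primePath
  have hS : ∀ p ∈ invertedPrimes, p.Prime := fun p hp => hp.1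
  rw [localizeIndex_mem_HTP_iff hA, mem_HTP_iff]
  constructor
  · rintro ⟨x, hx⟩
    rw [exists_codesZero_iff fun p hp => (hA p hp).1]
    refine ⟨fun i => x i, ?_, fun i p hp => ⟨fun h => ?_, fun h => ?_⟩⟩
    · have := map_evalTerms (invertPrimes invertedPrimes).subtype x (Denumerable.ofNat _ n)
      rw [hx, map_zero] at this
      exact this.symm
    · exact ((mem_invertPrimes_iff hS).1 (x i).2 2 Nat.prime_two h).2.1 rfl
    · obtain ⟨k, -, hk⟩ := mem_primePath_iff.1 hp
      exact (mem_invertedPrimes_iff.1 ((mem_invertPrimes_iff hS).1 (x i).2 p (hA p hp).1 h)).2.2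
        ⟨k, hk⟩
  · intro h
    have hc := codesZero_leastCode h
    obtain ⟨x, hx, hd⟩ := hc.exists_zero
    -- `CodesZero` excludes `2` from the denominator only if the list is nonempty; the initial `3`
    -- guarantees that.
    have h3 : 3 ∈ primePath leastCode n := mem_primePath_iff.2 ⟨0, Nat.zero_le _, rfl⟩
    have hmem : ∀ i, x i ∈ invertPrimes invertedPrimes := by
      intro i
      rw [mem_invertPrimes_iff hS]
      intro q hq hqd
      have hqd' := hqd.trans (hd i)
      rw [mem_invertedPrimes_iff]
      refine ⟨hq, ?_, ?_⟩
      · rintro rfl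
        exact (hc.2.1 3 h3).1 hqd'
      · rintro ⟨k, rfl⟩
        -- A prime protected after step `n` exceeds the least code, hence also the common
        -- denominator stored in it; one protected earlier is excluded by the code itself.
        rcases Nat.lt_or_ge n k with hk | hk
        · have h1 := Nat.le_of_dvd (Nat.pos_of_ne_zero hc.1) hqd'
          have h2 := Nat.unpair_left_le (leastCode (primePath leastCode n) n)
          have h4 := (le_max_right _ _).trans_lt (lt_headI_primePath_succ leastCode n)
          have h5 := (strictMono_headI_primePath leastCode).monotone (Nat.succ_le_of_lt hk)
          simp only [Nat.succ_eq_add_one] at h1 h5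
          omega
        · exact (hc.2.1 _ (mem_primePath_iff.2 ⟨k, hk, rfl⟩)).2 hqd'
    refine ⟨fun i => ⟨x i, hmem i⟩, Subtype.ext ?_⟩
    have := map_evalTerms (invertPrimes invertedPrimes).subtype (fun i => ⟨x i, hmem i⟩)
      (Denumerable.ofNat _ n)
    simp only [Subring.subtype_apply] at this
    rw [this, hx]
    rfl

theorem Nat.RecursiveIn.comp_total {O : Set (ℕ →. ℕ)} {f : ℕ →. ℕ} {g : ℕ → ℕ}
    (hf : Nat.RecursiveIn O f) (hg : Nat.RecursiveIn O fun n => Part.some (g n)) :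
    Nat.RecursiveIn O fun n => f (g n) :=
  (Nat.RecursiveIn.comp hf hg).of_eq fun _ => Part.bind_some _ _

theorem Nat.RecursiveIn.pair_total {O : Set (ℕ →. ℕ)} {f g : ℕ → ℕ}
    (hf : Nat.RecursiveIn O fun n => Part.some (f n))
    (hg : Nat.RecursiveIn O fun n => Part.some (g n)) :
    Nat.RecursiveIn O fun n => Part.some (Nat.pair (f n) (g n)) :=
  (Nat.RecursiveIn.pair hf hg).of_eq fun _ => by simp [Seq.seq]

theorem charFun_congr {A B : Set ℕ} {m n : ℕ} (h : m ∈ A ↔ n ∈ B) : charFun A m = charFun B n := by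
  by_cases hn : n ∈ B
  · simp [charFun, hn, h.2 hn]
  · simp [charFun, hn, mt h.1 hn]

theorem charFun_turingReducible_of_computable {A B : Set ℕ} {f : ℕ → ℕ} (hf : Computable f)
    (h : ∀ n, n ∈ A ↔ f n ∈ B) : TuringReducible (charFun A) (charFun B) := by
  rw [TuringReducible, RecursiveIn.iff_nat]
  have hf' : Nat.RecursiveIn {charFun B} fun n => Part.some (f n) :=
    RecursiveIn.iff_nat.1 hf.computableIn
  exact ((Nat.RecursiveIn.oracle _ (Set.mem_singleton _)).comp_total hf').of_eq fun n =>
    charFun_congr (h n).symm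

open Classical in
theorem recursiveIn_primePath_leastCode :
    Nat.RecursiveIn {charFun (HTP ℚ)} fun n => Part.some (Encodable.encode (primePath leastCode n)) := by
  have hy : Primrec fun n : ℕ => n.unpair.2.unpair.1 :=
    Primrec.fst.comp (Primrec.unpair.comp (Primrec.snd.comp Primrec.unpair))
  have hA : Primrec fun n : ℕ => Denumerable.ofNat (List ℕ) n.unpair.2.unpair.2 :=
    Primrec.list_ofNat.comp (Primrec.snd.comp (Primrec.unpair.comp
      (Primrec.snd.comp Primrec.unpair)))
  let g : ℕ → ℕ := fun n =>
    localizeIndex (Denumerable.ofNat (List ℕ) n.unpair.2.unpair.2) n.unpair.2.unpair.1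
  have hg : Nat.RecursiveIn {charFun (HTP ℚ)} fun n => Part.some (g n) :=
    RecursiveIn.iff_nat.1 (primrec_localizeIndex.comp hA hy).to_comp.computableIn
  -- One step of the recursion, with the oracle's answer as second component of `m`. If the answer
  -- is `1`, the unbounded search finds the least code; if it is `0`, the search stops at `0`, the
  -- default value of `leastCode`.
  let ψ : ℕ →. ℕ := fun m => (Nat.rfind fun c => Part.some (decide
    (CodesZero (Denumerable.ofNat _ m.unpair.1.unpair.2.unpair.1)
      (Denumerable.ofNat _ m.unpair.1.unpair.2.unpair.2) c ∨ m.unpair.2 = 0))).map fun c =>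
        Encodable.encode (extendPrimes (Denumerable.ofNat _ m.unpair.1.unpair.2.unpair.2) c)
  have hψ : Nat.RecursiveIn {charFun (HTP ℚ)} ψ := by
    have hfst : Primrec fun m : ℕ => m.unpair.1 := Primrec.fst.comp Primrec.unpair
    have hP : PrimrecPred fun q : ℕ × ℕ =>
        CodesZero (Denumerable.ofNat _ q.1.unpair.1.unpair.2.unpair.1)
          (Denumerable.ofNat _ q.1.unpair.1.unpair.2.unpair.2) q.2 ∨ q.1.unpair.2 = 0 :=
      (primrecPred_codesZero.comp (((Primrec.list_ofNat.comp (hy.comp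
        (hfst.comp Primrec.fst))).pair (hA.comp (hfst.comp Primrec.fst))).pair Primrec.snd)).or
        (Primrec.eq.comp (Primrec.snd.comp (Primrec.unpair.comp Primrec.fst)) (Primrec.const 0))
    have h1 : Partrec fun m : ℕ => Nat.rfind fun c => Part.some (decide
        (CodesZero (Denumerable.ofNat _ m.unpair.1.unpair.2.unpair.1)
          (Denumerable.ofNat _ m.unpair.1.unpair.2.unpair.2) c ∨ m.unpair.2 = 0)) :=
      Partrec.rfind hP.computablePred.decide.partrec
    exact RecursiveIn.iff_nat.1 (h1.map (Computable.encode.comp (computable_extendPrimes.comp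
      (hA.to_comp.comp (hfst.to_comp.comp Computable.fst)) Computable.snd)).to₂).recursiveIn
  let χ : ℕ → ℕ := fun n => if n ∈ HTP ℚ then 1 else 0
  have hχ : Nat.RecursiveIn {charFun (HTP ℚ)} fun n => Part.some (χ n) :=
    Nat.RecursiveIn.oracle _ (Set.mem_singleton _)
  have hid : Nat.RecursiveIn {charFun (HTP ℚ)} fun n => Part.some n :=
    RecursiveIn.iff_nat.1 RecursiveIn.some
  have hh := hψ.comp_total (hid.pair_total (hχ.comp_total hg))
  have hconst : Nat.RecursiveIn {charFun (HTP ℚ)} fun _ => Part.some (Encodable.encode [3]) :=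
    RecursiveIn.iff_nat.1 (Computable.const _).computableIn
  have hrec : Nat.RecursiveIn {charFun (HTP ℚ)}
      fun p => Part.some (Encodable.encode (primePath leastCode p.unpair.2)) := by
    refine (Nat.RecursiveIn.prec hconst hh).of_eq fun p => ?_
    dsimp only
    generalize p.unpair.1 = a
    generalize p.unpair.2 = n
    induction n with
    | zero => rfl
    | succ n ih =>
      dsimp only
      rw [ih]
      refine (Part.bind_some _ _).trans (Part.eq_some_iff.2 ?_)
      have hA' : ∀ p ∈ primePath leastCode n, p.Prime ∧ p % 4 = 3 :=
        fun p => prime_of_mem_primePath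
      simp only [ψ, g, χ, Nat.unpair_pair, Denumerable.ofNat_encode, localizeIndex_mem_HTP_iff hA',
        Part.mem_map_iff]
      refine ⟨leastCode (primePath leastCode n) n, ?_, rfl⟩
      refine Nat.mem_rfind.2 ?_
      by_cases h : ∃ c, CodesZero (Denumerable.ofNat _ n) (primePath leastCode n) c
      · simp only [h, if_true, one_ne_zero, or_false, Part.mem_some_iff]
        refine ⟨by simpa using codesZero_leastCode h, fun {m} hm => ?_⟩
        rw [leastCode, dif_pos h] at hm
        simpa using Nat.find_min h hm
      · have h0 : leastCode (primePath leastCode n) n = 0 := dif_neg h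
        simp [h, h0]
  have hpair : Nat.RecursiveIn {charFun (HTP ℚ)} fun n => Part.some (Nat.pair 0 n) :=
    RecursiveIn.iff_nat.1 (Primrec₂.natPair.comp (Primrec.const 0) Primrec.id).to_comp.computableIn
  exact (hrec.comp_total hpair).of_eq fun n => by simp

theorem htp_invertedPrimes_turingReducible :
    TuringReducible (charFun (HTP (invertPrimes invertedPrimes))) (charFun (HTP ℚ)) := by
  rw [TuringReducible, RecursiveIn.iff_nat]
  have hid : Nat.RecursiveIn {charFun (HTP ℚ)} fun n => Part.some n :=
    RecursiveIn.iff_nat.1 RecursiveIn.some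
  have hg : Nat.RecursiveIn {charFun (HTP ℚ)} fun m =>
      Part.some (localizeIndex (Denumerable.ofNat (List ℕ) m.unpair.1) m.unpair.2) :=
    RecursiveIn.iff_nat.1 (primrec_localizeIndex.comp (Primrec.list_ofNat.comp
      (Primrec.fst.comp Primrec.unpair)) (Primrec.snd.comp Primrec.unpair)).to_comp.computableIn
  refine ((Nat.RecursiveIn.oracle _ (Set.mem_singleton _)).comp_total
    (hg.comp_total (recursiveIn_primePath_leastCode.pair_total hid))).of_eq fun n => ?_
  refine charFun_congr ?_
  rw [mem_HTP_invertedPrimes_iff n, Nat.unpair_pair, Denumerable.ofNat_encode]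

theorem htp_rat_turingReducible (R : Subring ℚ) :
    TuringReducible (charFun (HTP ℚ)) (charFun (HTP R)) := by
  refine charFun_turingReducible_of_computable
    (f := fun n => Encodable.encode (clearDenTerms (Denumerable.ofNat _ n)))
    (Primrec.encode.comp (primrec_clearDenTerms.comp Primrec.list_ofNat)).to_comp fun n => ?_
  rw [encode_mem_HTP_iff, exists_zero_clearDenTerms_iff, mem_HTP_iff]

theorem corollaryC :
    ∃ S : Set ℕ,
      (∀ p ∈ S, Nat.Prime p) ∧
      S.Infinite ∧
      {p : ℕ | Nat.Prime p ∧ p ∉ S}.Infinite ∧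
      REPred (fun n : ℕ => n ∈ S) ∧
      SetTuringEquivalent (HTP (invertPrimes S)) (HTP ℚ) := by
  exact ⟨invertedPrimes, fun _ hp => hp.1, infinite_invertedPrimes, infinite_not_mem_invertedPrimes,
    rePred_invertedPrimes, htp_invertedPrimes_turingReducible, htp_rat_turingReducible _⟩
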